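/- Let $\mathcal G$ be a connected noncompact metric graph, made of finitely many bounded edges $[0,\ell_b]$ and at least one (but finitely many) halflines $[0,\infty)$, glued at their endpoints (the vertices); self-loops and multiple edges are allowed, and the degree of a vertex counts edge ends (a self-loop counts twice). Let $H^1(\mathcal G)$ be the space of real functions that are continuous on $\mathcal G$ and belong to $H^1$ of every edge, and let $2<p<6$. For $u\in H^1(\mathcal G)$ put $$E(u)=\tfrac12\int_{\mathcal G}|u'|^2\,dx-\tfrac1p\int_{\mathcal G}|u|^p\,dx .$$ For a bounded edge $e$ (a closed subset of $\mathcal G$, endpoints included) and $\mu>0$ put $$V=\{u\in H^1(\mathcal G):\ \|u\|_{L^\infty(e)}=\|u\|_{L^\infty(\mathcal G)}\},\qquad V_\mu=\{u\in V:\ \|u\|_{L^2(\mathcal G)}^2=\mu\}.$$ **Lemma.** There is $\mu_0>0$, depending only on $p$ and $\mathcal G$, such that the following holds for every bounded edge $e$ neither of whose endpoints has degree $2$ and for every $\mu\ge\mu_0$. If $u\in V_\mu$ satisfies $E(u)=\inf_{v\in V_\mu}E(v)$, then $$\|u\|_{L^\infty(e)}>\|u\|_{L^\infty(\mathcal G\setminus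 e)} .$$ Consequently $|u|$ attains its maximum over $\mathcal G$ at a point of $e$ and at no point outside $e$, and $u$ lies in the interior of $V$ for the norm of $H^1(\mathcal G)$: there is $\varepsilon>0$ such that every $v\in H^1(\mathcal G)$ with $\|v-u\|_{H^1(\mathcal G)}<\varepsilon$ belongs to $V$. -/

import Mathlib

open MeasureTheory Set
open scoped ENNReal

/-- The data of a metric graph with vertices `V`, bounded edges `B` and halflines `H`.  The bounded
edge `b` is a copy of `[0, len b]` whose endpoint `0` is attached at `src b` and whose endpoint
`len b` is attached at `tgt b`; the halfline `h` is a copy of `[0, ∞)` whose endpoint `0` is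
attached at `base h`.  Self-loops and multiple edges are allowed. -/
structure MetricGraph (V B H : Type*) where
  src : B → V
  tgt : B → V
  base : H → V
  len : B → ℝ
  len_pos : ∀ b, 0 < len b

namespace MetricGraph

variable {V B H : Type*} (G : MetricGraph V B H)

/-- Any two vertices are joined by a finite chain of bounded edges (travelled in any direction). -/
def Connected : Prop :=
  ∀ v w : V, Relation.EqvGen (fun x y => ∃ b : B, G.src b = x ∧ G.tgt b = y) v w

/-- The degree of a vertex: the number of edge ends attached at it (a self-loop counts twice). -/
noncomputable def degree (v : V) : ℕ :=
  Nat.card {b : B // G.src b = v} + Nat.card {b : B // G.tgt b = v} +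
    Nat.card {h : H // G.base h = v}

/-- The coordinate interval of an edge. -/
def dom : B ⊕ H → Set ℝ
  | Sum.inl b => Icc 0 (G.len b)
  | Sum.inr _ => Ici 0

/-- The identifications: endpoints of edges are glued to the vertices they are attached at. -/
inductive Glue : V ⊕ (Σ a : B ⊕ H, G.dom a) → V ⊕ (Σ a : B ⊕ H, G.dom a) → Prop
  | src (b : B) : Glue (Sum.inr ⟨Sum.inl b, ⟨0, left_mem_Icc.2 (G.len_pos b).le⟩⟩)
      (Sum.inl (G.src b))
  | tgt (b : B) : Glue (Sum.inr ⟨Sum.inl b, ⟨G.len b, right_mem_Icc.2 (G.len_pos b).le⟩⟩)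
      (Sum.inl (G.tgt b))
  | base (h : H) : Glue (Sum.inr ⟨Sum.inr h, ⟨0, self_mem_Ici⟩⟩) (Sum.inl (G.base h))

/-- The points of the metric graph: the disjoint union of vertices and closed edges, glued. -/
def Pt : Type _ := Quot G.Glue

/-- The point with coordinate `x` on the edge `a`. -/
def pt (a : B ⊕ H) (x : G.dom a) : G.Pt := Quot.mk _ (Sum.inr ⟨a, x⟩)

/-- The closed edge `a` (endpoints included), as a subset of the graph. -/
def edge (a : B ⊕ H) : Set G.Pt := range (G.pt a)

/-- The restriction of `u` to the edge `a` in the coordinate of that edge, extended to `ℝ` by its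
values at the endpoints (the extension is never used outside `dom a`). -/
noncomputable def onEdge (u : G.Pt → ℝ) : B ⊕ H → ℝ → ℝ
  | Sum.inl b => IccExtend (G.len_pos b).le (fun x => u (G.pt (Sum.inl b) x))
  | Sum.inr h => IciExtend (fun x => u (G.pt (Sum.inr h) x))

/-- The space `H¹(G)` (real-valued): on each edge `u` is locally absolutely continuous up to the
endpoints, with `u` and its almost everywhere derivative square integrable.  Continuity at the
vertices is automatic, since a function on the glued space has one value at each vertex. -/
def MemH1 (u : G.Pt → ℝ) : Prop :=
  ∀ a : B ⊕ H,
    (∀ c ∈ G.dom a, AbsolutelyContinuousOnInterval (G.onEdge u a) 0 c) ∧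
    MemLp (G.onEdge u a) 2 (volume.restrict (G.dom a)) ∧
    MemLp (deriv (G.onEdge u a)) 2 (volume.restrict (G.dom a))

/-- The norm of `u` in `L^∞(S)`, for `u` continuous: the supremum of `|u|` over `S`. -/
noncomputable def supNorm (u : G.Pt → ℝ) (S : Set G.Pt) : ℝ≥0∞ := ⨆ x ∈ S, ‖u x‖ₑ

variable [Fintype B] [Fintype H]

/-- The mass `‖u‖²` in `L²(G)`. -/
noncomputable def mass (u : G.Pt → ℝ) : ℝ :=
  ∑ a : B ⊕ H, ∫ x in G.dom a, (G.onEdge u a x) ^ 2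

/-- The Dirichlet integral `‖u'‖²` in `L²(G)`. -/
noncomputable def dirichlet (u : G.Pt → ℝ) : ℝ :=
  ∑ a : B ⊕ H, ∫ x in G.dom a, (deriv (G.onEdge u a) x) ^ 2

/-- The NLS energy with exponent `p`. -/
noncomputable def energy (p : ℝ) (u : G.Pt → ℝ) : ℝ :=
  (1 / 2) * G.dirichlet u - (1 / p) * ∑ a : B ⊕ H, ∫ x in G.dom a, |G.onEdge u a x| ^ p

/-- The norm of `H¹(G)`. -/
noncomputable def normH1 (u : G.Pt → ℝ) : ℝ := Real.sqrt (G.mass u + G.dirichlet u)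

/-- The functions of `H¹(G)` whose `L^∞` norm is achieved on the bounded edge `e`. -/
def maxOn (e : B) : Set (G.Pt → ℝ) :=
  {u | G.MemH1 u ∧ G.supNorm u (G.edge (Sum.inl e)) = G.supNorm u univ}

/-- The functions in `maxOn e` of mass `μ`. -/
def maxOnMass (e : B) (μ : ℝ) : Set (G.Pt → ℝ) := {u | u ∈ G.maxOn e ∧ G.mass u = μ}

end MetricGraph

/-! Suppose that |u| also comes up to its maximum M off `e`. Write Φ = `calibInt p M`, C = `calibInt
p 1 1`, r = (p/2+1)/(p-2), and let l be a lower bound for all edge lengths. Since |u| ≤ M, the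
quantity E(u) + M^(p-2) μ / p is the integral of (u'² + Φ'(u)²)/2, so by Young's inequality it
dominates the total variation of Φ∘u (`MemH1.energy_add_eq`, `abs_calibInt_sub_le`). The mass forces
|u| ≤ δ = √(μ/l) somewhere on every edge, so each branch of u between the levels δ and M costs at
least Φ(M) - Φ(δ). Peaks on two edges force two branches, and even three when both ends of `e` have
degree at least 3 (`MemH1.three_mul_le_sum_action`).

The competitor lives on `e` alone and consists of N halves of a truncated soliton: N = 1 at an end
of degree 1 if there is one, N = 2 at the midpoint otherwise. In both cases u pays for at least N +
1 branches, one more than the competitor.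

If A is the amplitude of the competitor, its energy is close to -N (r-1) C A^(p/2+1). With y =
(M/A)^(p-2) one has Φ(M) = C A^(p/2+1) y^r, and the comparison reduces to N(r-1) + (N+1) y^r - N r y
> 0. This is Bernoulli's inequality with a spare y^r, and uses r > 1, that is p < 6. The error Φ(δ)
is of lower order for large μ (`bump_energy_le_lower_bound`). So u was not a minimizer. Interiority
follows from the strict gap and the embedding of H¹ into bounded functions. -/

/-! ### The calibration and its primitive -/

/-- The square root of twice the potential of the soliton with peak `M`. -/
noncomputable def calib (p M s : ℝ) : ℝ := √(2 / p) * s * √(M ^ (p - 2) - |s| ^ (p - 2))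

/-- The primitive of `calib` vanishing at `0`. -/
noncomputable def calibInt (p M t : ℝ) : ℝ := ∫ s in (0 : ℝ)..t, calib p M s

lemma continuous_calib {p : ℝ} (hp : 2 < p) (M : ℝ) : Continuous (calib p M) := by
  have h : Continuous fun s : ℝ => |s| ^ (p - 2) :=
    continuous_abs.rpow_const fun _ => Or.inr (by linarith)
  unfold calib
  fun_prop

lemma hasDerivAt_calibInt {p : ℝ} (hp : 2 < p) (M t : ℝ) :
    HasDerivAt (calibInt p M) (calib p M t) t :=
  intervalIntegral.integral_hasDerivAt_right ((continuous_calib hp M).intervalIntegrable _ _)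
    (continuous_calib hp M).stronglyMeasurable.stronglyMeasurableAtFilter
    (continuous_calib hp M).continuousAt

lemma continuous_calibInt {p : ℝ} (hp : 2 < p) (M : ℝ) : Continuous (calibInt p M) :=
  continuous_iff_continuousAt.2 fun t => (hasDerivAt_calibInt hp M t).continuousAt

@[simp] lemma calibInt_zero (p M : ℝ) : calibInt p M 0 = 0 := by simp [calibInt]

lemma calib_neg (p M s : ℝ) : calib p M (-s) = -calib p M s := by simp [calib]

lemma calib_nonneg (p M : ℝ) {s : ℝ} (hs : 0 ≤ s) : 0 ≤ calib p M s := by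
  unfold calib; positivity

/-- The bound |s| ≤ M is essential: beyond M the radicand is negative and the square root takes the
value 0. -/
lemma calib_sq {p M s : ℝ} (hp : 2 < p) (hs : |s| ≤ M) :
    calib p M s ^ 2 = 2 / p * (M ^ (p - 2) * s ^ 2 - |s| ^ p) := by
  have h1 : |s| ^ (p - 2) ≤ M ^ (p - 2) :=
    Real.rpow_le_rpow (abs_nonneg s) hs (by linarith)
  have h2 : |s| ^ p = |s| ^ (p - 2) * s ^ 2 := by
    rcases eq_or_ne s 0 with rfl | h0
    · simp [Real.zero_rpow (show p ≠ 0 by linarith)]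
    · rw [← sq_abs s, ← Real.rpow_natCast, ← Real.rpow_add (abs_pos.2 h0)]
      norm_num
  unfold calib
  rw [mul_pow, mul_pow, Real.sq_sqrt (by positivity), Real.sq_sqrt (by linarith), h2]
  ring

lemma calibInt_neg (p M t : ℝ) : calibInt p M (-t) = calibInt p M t := by
  unfold calibInt
  have := intervalIntegral.integral_comp_neg (a := 0) (b := t) (fun s => calib p M s)
  simp only [calib_neg, intervalIntegral.integral_neg, neg_zero] at this
  rw [intervalIntegral.integral_symm, ← this, neg_neg]

lemma calibInt_abs (p M t : ℝ) : calibInt p M |t| = calibInt p M t := by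
  rcases abs_choice t with h | h <;> rw [h]
  exact calibInt_neg p M t

lemma calibInt_mono {p : ℝ} (hp : 2 < p) (M : ℝ) {s t : ℝ} (hs : 0 ≤ s) (hst : s ≤ t) :
    calibInt p M s ≤ calibInt p M t := by
  have h := intervalIntegral.integral_interval_sub_left
    ((continuous_calib hp M).intervalIntegrable (μ := volume) 0 t)
    ((continuous_calib hp M).intervalIntegrable 0 s)
  have h2 : 0 ≤ ∫ x in s..t, calib p M x :=
    intervalIntegral.integral_nonneg hst fun x hx => calib_nonneg p M (hs.trans hx.1)
  unfold calibInt
  linarith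

lemma calibInt_nonneg {p : ℝ} (hp : 2 < p) (M t : ℝ) : 0 ≤ calibInt p M t := by
  rw [← calibInt_abs, ← calibInt_zero p M]
  exact calibInt_mono hp M le_rfl (abs_nonneg t)

lemma calibInt_le_of_abs_le {p : ℝ} (hp : 2 < p) (M : ℝ) {s t : ℝ} (h : |s| ≤ t) :
    calibInt p M s ≤ calibInt p M t := by
  rw [← calibInt_abs p M s]
  exact calibInt_mono hp M (abs_nonneg s) h

/-- Scaling s = M r: the cost of one full branch is homogeneous in the peak, so the single constant
`calibInt p 1 1` serves all M. -/
lemma calibInt_self {p M : ℝ} (hp : 2 < p) (hM : 0 ≤ M) :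
    calibInt p M M = M ^ (p / 2 + 1) * calibInt p 1 1 := by
  rcases hM.eq_or_lt with rfl | hM
  · simp [Real.zero_rpow (show p / 2 + 1 ≠ 0 by linarith)]
  have h : ∀ r ∈ uIcc (0 : ℝ) 1, calib p M (M * r) = M ^ (p / 2) * calib p 1 r := by
    intro r hr
    have hr0 : 0 ≤ r := by simpa using hr.1
    have e : M ^ (p - 2) - |M * r| ^ (p - 2) = (M ^ (p / 2 - 1)) ^ 2 * (1 - |r| ^ (p - 2)) := by
      rw [abs_mul, abs_of_pos hM, Real.mul_rpow hM.le (abs_nonneg r), ← Real.rpow_natCast,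
        ← Real.rpow_mul hM.le]
      norm_num
      ring_nf
    unfold calib
    rw [e, Real.sqrt_mul (by positivity), Real.sqrt_sq (by positivity), Real.one_rpow,
      Real.rpow_sub_one hM.ne']
    field_simp
  have h2 := intervalIntegral.mul_integral_comp_mul_left (a := 0) (b := 1)
    (f := calib p M) (c := M)
  rw [mul_zero, mul_one, intervalIntegral.integral_congr h, intervalIntegral.integral_const_mul] at h2
  unfold calibInt
  rw [← h2, Real.rpow_add_one hM.ne']
  ring

/-- Dropping |s|^(p-2) under the root leaves a linear integrand. With t² = μ/l this controls the
loss from branches that stop at a low level instead of 0. -/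
lemma calibInt_le {p M t : ℝ} (hp : 2 < p) (hM : 0 ≤ M) (ht : 0 ≤ t) :
    calibInt p M t ≤ √(2 / p) * M ^ (p / 2 - 1) * (t ^ 2 / 2) := by
  have e : √(M ^ (p - 2)) = M ^ (p / 2 - 1) := by
    rw [Real.sqrt_eq_rpow, ← Real.rpow_mul hM]
    ring_nf
  have h : ∀ s ∈ Icc 0 t, calib p M s ≤ √(2 / p) * M ^ (p / 2 - 1) * s := by
    intro s hs
    have h1 : √(M ^ (p - 2) - |s| ^ (p - 2)) ≤ M ^ (p / 2 - 1) := by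
      rw [← e]
      exact Real.sqrt_le_sqrt (by linarith [Real.rpow_nonneg (abs_nonneg s) (p - 2)])
    unfold calib
    calc _ ≤ √(2 / p) * s * M ^ (p / 2 - 1) :=
          mul_le_mul_of_nonneg_left h1 (mul_nonneg (Real.sqrt_nonneg _) hs.1)
      _ = _ := by ring
  refine (intervalIntegral.integral_mono_on ht ((continuous_calib hp M).intervalIntegrable _ _)
    (Continuous.intervalIntegrable (by fun_prop) _ _) h).trans ?_
  rw [intervalIntegral.integral_const_mul, integral_id]
  simp

lemma calibInt_one_pos {p : ℝ} (hp : 2 < p) : 0 < calibInt p 1 1 := by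
  refine intervalIntegral.intervalIntegral_pos_of_pos_on
    ((continuous_calib hp 1).intervalIntegrable _ _) (fun s hs => ?_) one_pos
  have h1 : |s| ^ (p - 2) < 1 := by
    rw [abs_of_pos hs.1]
    exact Real.rpow_lt_one hs.1.le hs.2 (by linarith)
  have h2 : 0 < √((1 : ℝ) ^ (p - 2) - |s| ^ (p - 2)) :=
    Real.sqrt_pos.2 (by rw [Real.one_rpow]; linarith)
  have h3 : 0 < √(2 / p) := Real.sqrt_pos.2 (by positivity)
  unfold calib
  exact mul_pos (mul_pos h3 hs.1) h2

/-! ### Variation estimates on an interval -/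

/-- The action density that bounds the variation of `calibInt p M ∘ f`. -/
noncomputable def actionDensity (p M : ℝ) (f : ℝ → ℝ) (x : ℝ) : ℝ :=
  1 / 2 * deriv f x ^ 2 + 1 / 2 * calib p M (f x) ^ 2

lemma actionDensity_nonneg (p M : ℝ) (f : ℝ → ℝ) (x : ℝ) : 0 ≤ actionDensity p M f x := by
  unfold actionDensity; positivity

lemma LipschitzOnWith.comp_absolutelyContinuousOnInterval {f g : ℝ → ℝ} {a b : ℝ} {K : NNReal}
    {s : Set ℝ} (hg : LipschitzOnWith K g s) (hf : AbsolutelyContinuousOnInterval f a b)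
    (hs : MapsTo f (uIcc a b) s) : AbsolutelyContinuousOnInterval (g ∘ f) a b := by
  rw [absolutelyContinuousOnInterval_iff] at hf ⊢
  intro ε hε
  obtain ⟨δ, hδ, h⟩ := hf (ε / (K + 1)) (by positivity)
  refine ⟨δ, hδ, fun E hE hlt => ?_⟩
  have h1 := h E hE hlt
  have h2 : ∑ i ∈ Finset.range E.1, dist ((g ∘ f) (E.2 i).1) ((g ∘ f) (E.2 i).2) ≤
      (K + 1) * ∑ i ∈ Finset.range E.1, dist (f (E.2 i).1) (f (E.2 i).2) := by
    rw [Finset.mul_sum]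
    refine Finset.sum_le_sum fun i hi => ?_
    refine (hg.dist_le_mul _ (hs (hE.1 i hi).1) _ (hs (hE.1 i hi).2)).trans ?_
    gcongr
    linarith
  refine h2.trans_lt ?_
  rw [lt_div_iff₀ (by positivity)] at h1
  linarith

/-- Young's inequality |Φ'(f) f'| ≤ (f'² + Φ'(f)²)/2, integrated. As `f` is bounded, the C¹ function
Φ is Lipschitz on its range, so Φ∘f is absolutely continuous and the fundamental theorem of calculus
applies to it. -/
lemma abs_calibInt_sub_le {p M a b : ℝ} (hp : 2 < p) (hab : a ≤ b) {f : ℝ → ℝ}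
    (hf : AbsolutelyContinuousOnInterval f a b)
    (hd : IntegrableOn (fun x => deriv f x ^ 2) (Icc a b)) :
    |calibInt p M (f b) - calibInt p M (f a)| ≤ ∫ x in a..b, actionDensity p M f x := by
  obtain ⟨R, hR⟩ := hf.exists_bound
  have hC1 : ContDiff ℝ 1 (calibInt p M) := by
    rw [contDiff_one_iff_deriv]
    refine ⟨fun t => (hasDerivAt_calibInt hp M t).differentiableAt, ?_⟩
    have : deriv (calibInt p M) = calib p M := funext fun t => (hasDerivAt_calibInt hp M t).deriv
    rw [this]
    exact continuous_calib hp M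
  obtain ⟨K, hK⟩ := hC1.contDiffOn.exists_lipschitzOnWith (s := Icc (-R) R) (by decide)
    (convex_Icc _ _) isCompact_Icc
  have hac := hK.comp_absolutelyContinuousOnInterval hf fun x hx => abs_le.1 (hR x hx)
  have hae : ∀ᵐ x, x ∈ uIcc a b →
      deriv (calibInt p M ∘ f) x = calib p M (f x) * deriv f x := by
    filter_upwards [hf.ae_differentiableAt] with x hx hxI
    exact ((hasDerivAt_calibInt hp M (f x)).comp x (hx hxI).hasDerivAt).deriv
  have hint := hac.integral_deriv_eq_sub
  have hii := hac.intervalIntegrable_deriv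
  have hcf : ContinuousOn (fun x => calib p M (f x) ^ 2) (uIcc a b) :=
    ((continuous_calib hp M).comp_continuousOn hf.continuousOn).pow 2
  have hAi : IntervalIntegrable (actionDensity p M f) volume a b := by
    refine IntervalIntegrable.add (IntervalIntegrable.const_mul ?_ _)
      ((hcf.intervalIntegrable).const_mul _)
    rw [intervalIntegrable_iff_integrableOn_Icc_of_le hab]
    exact hd
  rw [show calibInt p M (f b) - calibInt p M (f a) =
    ∫ x in a..b, deriv (calibInt p M ∘ f) x from hint.symm]
  refine (intervalIntegral.abs_integral_le_integral_abs hab).trans ?_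
  refine intervalIntegral.integral_mono_ae_restrict hab hii.abs hAi ?_
  have hae' := (ae_restrict_iff' (measurableSet_Icc (a := a) (b := b))).2
    (by simpa only [uIcc_of_le hab] using hae)
  filter_upwards [hae'] with x hx
  rw [hx, abs_le]
  unfold actionDensity
  constructor <;> nlinarith [sq_nonneg (deriv f x - calib p M (f x)),
    sq_nonneg (deriv f x + calib p M (f x))]

lemma exists_mul_sq_le_integral {f : ℝ → ℝ} {c l : ℝ} (hl : 0 ≤ l)
    (hf : ContinuousOn f (Icc c (c + l))) :
    ∃ z ∈ Icc c (c + l), l * f z ^ 2 ≤ ∫ x in Icc c (c + l), f x ^ 2 := by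
  obtain ⟨z, hz, hmin⟩ := isCompact_Icc.exists_isMinOn (nonempty_Icc.2 (by linarith)) (hf.pow 2)
  refine ⟨z, hz, ?_⟩
  have h := setIntegral_mono_on (μ := volume) (s := Icc c (c + l)) (f := fun _ => f z ^ 2)
    (g := fun x => f x ^ 2) (integrable_const _) ((hf.pow 2).integrableOn_Icc) measurableSet_Icc
    (fun x hx => hmin hx)
  simpa [hl] using h

/-! ### Points and edges of the graph, and the Sobolev embedding -/

namespace MetricGraph

variable {V B H : Type*} (G : MetricGraph V B H)

lemma zero_mem_dom (a : B ⊕ H) : (0 : ℝ) ∈ G.dom a := by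
  rcases a with b | h
  · exact left_mem_Icc.2 (G.len_pos b).le
  · exact self_mem_Ici

lemma ordConnected_dom (a : B ⊕ H) : (G.dom a).OrdConnected := by
  rcases a with b | h
  · exact ordConnected_Icc
  · exact ordConnected_Ici

lemma measurableSet_dom (a : B ⊕ H) : MeasurableSet (G.dom a) :=
  (G.ordConnected_dom a).measurableSet

lemma nonneg_of_mem_dom {a : B ⊕ H} {x : ℝ} (hx : x ∈ G.dom a) : 0 ≤ x := by
  rcases a with b | h
  · exact hx.1
  · exact hx

lemma onEdge_apply (u : G.Pt → ℝ) (a : B ⊕ H) {x : ℝ} (hx : x ∈ G.dom a) :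
    G.onEdge u a x = u (G.pt a ⟨x, hx⟩) := by
  rcases a with b | h
  · exact IccExtend_of_mem _ _ hx
  · exact IciExtend_of_mem _ hx

lemma onEdge_sub (u v : G.Pt → ℝ) (a : B ⊕ H) :
    G.onEdge (v - u) a = G.onEdge v a - G.onEdge u a := by
  rcases a with b | h <;> rfl

/-- The point of the graph at the vertex `y`. -/
def vtx (y : V) : G.Pt := Quot.mk _ (Sum.inl y)

lemma pt_src (b : B) : G.pt (Sum.inl b) ⟨0, G.zero_mem_dom _⟩ = G.vtx (G.src b) :=
  Quot.sound (Glue.src b)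

lemma len_mem_dom (b : B) : G.len b ∈ G.dom (Sum.inl b : B ⊕ H) :=
  right_mem_Icc.2 (G.len_pos b).le

lemma pt_tgt (b : B) : G.pt (Sum.inl b) ⟨G.len b, G.len_mem_dom b⟩ = G.vtx (G.tgt b) :=
  Quot.sound (Glue.tgt b)

lemma pt_base (h : H) : G.pt (Sum.inr h) ⟨0, G.zero_mem_dom _⟩ = G.vtx (G.base h) :=
  Quot.sound (Glue.base h)

/-- The edge `a` has an end at the vertex `y`. -/
def Incident (a : B ⊕ H) (y : V) : Prop := ∃ x : G.dom a, G.pt a x = G.vtx y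

lemma incident_src (b : B) : G.Incident (Sum.inl b) (G.src b) := ⟨_, G.pt_src b⟩

lemma incident_tgt (b : B) : G.Incident (Sum.inl b) (G.tgt b) := ⟨_, G.pt_tgt b⟩

lemma incident_base (h : H) : G.Incident (Sum.inr h) (G.base h) := ⟨_, G.pt_base h⟩

variable {G}

/-- An isolated vertex would be a point on no edge, where a function is not controlled by its edge
data. A chain joining the vertex to the base of a halfline excludes this. -/
lemma Connected.exists_incident [Nonempty H] (hG : G.Connected) (y : V) :
    ∃ a : B ⊕ H, G.Incident a y := by
  have key : ∀ v w, Relation.EqvGen (fun x y => ∃ b : B, G.src b = x ∧ G.tgt b = y) v w →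
      v = w ∨ (∃ a : B ⊕ H, G.Incident a v) ∧ (∃ a : B ⊕ H, G.Incident a w) := by
    intro v w h
    induction h with
    | rel x y h =>
      obtain ⟨b, rfl, rfl⟩ := h
      exact Or.inr ⟨⟨_, G.incident_src b⟩, ⟨_, G.incident_tgt b⟩⟩
    | refl x => exact Or.inl rfl
    | symm x y _ ih => exact ih.imp Eq.symm And.symm
    | trans x y z _ _ ih1 ih2 =>
      rcases ih1 with rfl | h1
      · exact ih2
      · rcases ih2 with rfl | h2
        · exact Or.inr h1
        · exact Or.inr ⟨h1.1, h2.2⟩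
  obtain ⟨h⟩ := ‹Nonempty H›
  rcases key y (G.base h) (hG _ _) with rfl | h1
  · exact ⟨_, G.incident_base h⟩
  · exact h1.1

lemma Connected.exists_pt_eq [Nonempty H] (hG : G.Connected) (P : G.Pt) :
    ∃ (a : B ⊕ H) (x : G.dom a), G.pt a x = P := by
  induction P using Quot.ind with
  | _ z =>
    rcases z with y | ⟨a, x⟩
    · exact hG.exists_incident y
    · exact ⟨a, x, rfl⟩

lemma MemH1.absolutelyContinuous {u : G.Pt → ℝ} (hu : G.MemH1 u) {a : B ⊕ H} {x y : ℝ}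
    (hx : x ∈ G.dom a) (hy : y ∈ G.dom a) :
    AbsolutelyContinuousOnInterval (G.onEdge u a) x y := by
  have hm : max x y ∈ G.dom a := by rcases max_choice x y with h | h <;> rwa [h]
  refine ((hu a).1 _ hm).mono ?_
  rw [uIcc_of_le (G.nonneg_of_mem_dom hm)]
  exact Icc_subset_Icc (le_min (G.nonneg_of_mem_dom hx) (G.nonneg_of_mem_dom hy)) le_rfl

lemma MemH1.continuousOn {u : G.Pt → ℝ} (hu : G.MemH1 u) {a : B ⊕ H} {x y : ℝ}
    (hx : x ∈ G.dom a) (hy : y ∈ G.dom a) : ContinuousOn (G.onEdge u a) (Icc x y) :=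
  (hu.absolutelyContinuous hx hy).continuousOn.mono Icc_subset_uIcc

lemma MemH1.integrableOn_sq {u : G.Pt → ℝ} (hu : G.MemH1 u) (a : B ⊕ H) :
    IntegrableOn (fun x => G.onEdge u a x ^ 2) (G.dom a) := (hu a).2.1.integrable_sq

lemma MemH1.integrableOn_deriv_sq {u : G.Pt → ℝ} (hu : G.MemH1 u) (a : B ⊕ H) :
    IntegrableOn (fun x => deriv (G.onEdge u a) x ^ 2) (G.dom a) := (hu a).2.2.integrable_sq

lemma MemH1.sub {u v : G.Pt → ℝ} (hv : G.MemH1 v) (hu : G.MemH1 u) : G.MemH1 (v - u) := by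
  intro a
  rw [onEdge_sub]
  refine ⟨fun c hc => ((hv a).1 c hc).sub ((hu a).1 c hc), (hv a).2.1.sub (hu a).2.1, ?_⟩
  refine ((hv a).2.2.sub (hu a).2.2).ae_eq ?_
  rw [Filter.EventuallyEq, ae_restrict_iff' (G.measurableSet_dom a)]
  have key : ∀ w : G.Pt → ℝ, G.MemH1 w →
      ∀ᵐ x, x ∈ G.dom a → DifferentiableAt ℝ (G.onEdge w a) x := by
    intro w hw
    -- On a halfline absolute continuity is only known on compact intervals, so almost everywhere
    -- differentiability is collected over a countable exhaustion.
    have h1 : ∀ n : ℕ, ∀ᵐ x, x ∈ G.dom a → x ≤ n → DifferentiableAt ℝ (G.onEdge w a) x := by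
      intro n
      rcases a with b | h
      · filter_upwards [((hw _).1 _ (G.len_mem_dom b)).ae_differentiableAt] with x hx hxd _
        exact hx (Icc_subset_uIcc hxd)
      · filter_upwards [((hw (Sum.inr h)).1 n (show (0 : ℝ) ≤ n by positivity)).ae_differentiableAt]
          with x hx hxd hxn
        exact hx (Icc_subset_uIcc ⟨hxd, hxn⟩)
    filter_upwards [ae_all_iff.2 h1] with x hx hxd
    obtain ⟨n, hn⟩ := exists_nat_ge x
    exact hx n hxd hn
  filter_upwards [key v hv, key u hu] with x h1 h2 hx
  exact (deriv_sub (h1 hx) (h2 hx)).symm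

lemma exists_len_lower_bound [Finite B] (G : MetricGraph V B H) :
    ∃ l : ℝ, 0 < l ∧ l ≤ 1 ∧ ∀ b, l ≤ G.len b := by
  rcases isEmpty_or_nonempty B with hB | hB
  · exact ⟨1, one_pos, le_rfl, fun b => hB.elim b⟩
  · obtain ⟨b₀, hb₀⟩ := Finite.exists_min G.len
    exact ⟨min 1 (G.len b₀), lt_min one_pos (G.len_pos b₀), min_le_left _ _,
      fun b => (min_le_right _ _).trans (hb₀ b)⟩

lemma exists_Icc_subset_dom {l : ℝ} (hl : 0 < l) (hlen : ∀ b, l ≤ G.len b) {a : B ⊕ H} {x : ℝ}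
    (hx : x ∈ G.dom a) : ∃ c, x ∈ Icc c (c + l) ∧ Icc c (c + l) ⊆ G.dom a := by
  rcases a with b | h
  · rcases le_total (x + l) (G.len b) with h1 | h1
    · exact ⟨x, ⟨le_rfl, by linarith⟩, Icc_subset_Icc hx.1 h1⟩
    · refine ⟨G.len b - l, ⟨by linarith, by linarith [hx.2]⟩, Icc_subset_Icc ?_ ?_⟩ <;>
        linarith [hlen b]
  · refine ⟨x, ⟨le_rfl, by linarith⟩, fun y hy => le_trans (show 0 ≤ x from hx) hy.1⟩

section Fintype

variable [Fintype B] [Fintype H]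

lemma integral_sq_le_mass (u : G.Pt → ℝ) (a : B ⊕ H) :
    ∫ x in G.dom a, G.onEdge u a x ^ 2 ≤ G.mass u :=
  Finset.single_le_sum (f := fun a => ∫ x in G.dom a, G.onEdge u a x ^ 2)
    (fun _ _ => integral_nonneg fun _ => sq_nonneg _) (Finset.mem_univ a)

lemma integral_deriv_sq_le_dirichlet (u : G.Pt → ℝ) (a : B ⊕ H) :
    ∫ x in G.dom a, deriv (G.onEdge u a) x ^ 2 ≤ G.dirichlet u :=
  Finset.single_le_sum (f := fun a => ∫ x in G.dom a, deriv (G.onEdge u a) x ^ 2)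
    (fun _ _ => integral_nonneg fun _ => sq_nonneg _) (Finset.mem_univ a)

lemma mass_nonneg (u : G.Pt → ℝ) : 0 ≤ G.mass u :=
  Finset.sum_nonneg fun _ _ => integral_nonneg fun _ => sq_nonneg _

lemma dirichlet_nonneg (u : G.Pt → ℝ) : 0 ≤ G.dirichlet u :=
  Finset.sum_nonneg fun _ _ => integral_nonneg fun _ => sq_nonneg _

lemma MemH1.exists_mul_sq_le_mass {u : G.Pt → ℝ} (hu : G.MemH1 u) {l : ℝ} (hl : 0 < l)
    {a : B ⊕ H} {c : ℝ} (hc : Icc c (c + l) ⊆ G.dom a) :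
    ∃ z ∈ Icc c (c + l), l * G.onEdge u a z ^ 2 ≤ G.mass u := by
  obtain ⟨z, hz, h⟩ := exists_mul_sq_le_integral hl.le
    (hu.continuousOn (hc (left_mem_Icc.2 (by linarith))) (hc (right_mem_Icc.2 (by linarith))))
  exact ⟨z, hz, h.trans ((setIntegral_mono_set (hu.integrableOn_sq a)
    (ae_of_all _ fun _ => sq_nonneg _) hc.eventuallyLE).trans (integral_sq_le_mass u a))⟩

/-- The Sobolev embedding of `H¹(G)` into the bounded functions. -/
lemma MemH1.abs_le {u : G.Pt → ℝ} (hu : G.MemH1 u) {l s : ℝ} (hl : 0 < l) (hl1 : l ≤ 1)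
    (hlen : ∀ b, l ≤ G.len b) (hs : 0 < s) (hus : G.mass u + G.dirichlet u ≤ s ^ 2)
    (a : B ⊕ H) (x : G.dom a) : |u (G.pt a x)| ≤ s * (1 / √l + 1) := by
  obtain ⟨c, hxc, hc⟩ := exists_Icc_subset_dom hl hlen x.2
  obtain ⟨z, hz, hzm⟩ := hu.exists_mul_sq_le_mass hl hc
  have hM := mass_nonneg u
  have hD := dirichlet_nonneg u
  have hac := hu.absolutelyContinuous (hc hz) x.2
  have hsub : uIcc z x ⊆ Icc c (c + l) := ordConnected_Icc.uIcc_subset hz hxc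
  have h1 : |G.onEdge u a z| ≤ s * (1 / √l) := by
    rw [mul_one_div, le_div_iff₀ (Real.sqrt_pos.2 hl)]
    refine (sq_le_sq₀ (by positivity) hs.le).1 ?_
    rw [mul_pow, sq_abs, Real.sq_sqrt hl.le]
    linarith
  have hint : IntegrableOn (fun y => deriv (G.onEdge u a) y ^ 2) (Icc c (c + l)) :=
    (hu.integrableOn_deriv_sq a).mono_set hc
  have hint2 : IntegrableOn (fun y => deriv (G.onEdge u a) y ^ 2 / (2 * s) + s / 2)
      (Icc c (c + l)) := (hint.div_const _).add (integrable_const _)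
  -- Young's inequality |u'| ≤ u'²/(2s) + s/2 takes the place of Cauchy–Schwarz; the interval has
  -- length l ≤ 1, so each term contributes at most s/2.
  have h2 : |G.onEdge u a x - G.onEdge u a z| ≤ s := by
    rw [← hac.integral_deriv_eq_sub]
    calc |∫ y in z..x, deriv (G.onEdge u a) y|
        ≤ ∫ y in uIoc z x, |deriv (G.onEdge u a) y| :=
          intervalIntegral.norm_integral_le_integral_norm_uIoc
            (f := fun y => deriv (G.onEdge u a) y)
      _ ≤ ∫ y in uIoc z x, (deriv (G.onEdge u a) y ^ 2 / (2 * s) + s / 2) := by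
          refine setIntegral_mono_on (intervalIntegrable_iff.1 hac.intervalIntegrable_deriv).abs
            (hint2.mono_set (uIoc_subset_uIcc.trans hsub)) measurableSet_uIoc fun y _ => ?_
          rw [div_add_div _ _ (by positivity) (by positivity), le_div_iff₀ (by positivity)]
          nlinarith [sq_nonneg (|deriv (G.onEdge u a) y| - s), sq_abs (deriv (G.onEdge u a) y)]
      _ ≤ ∫ y in Icc c (c + l), (deriv (G.onEdge u a) y ^ 2 / (2 * s) + s / 2) :=
          setIntegral_mono_set hint2 (ae_of_all _ fun _ => by positivity)
            (uIoc_subset_uIcc.trans hsub).eventuallyLE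
      _ = (∫ y in Icc c (c + l), deriv (G.onEdge u a) y ^ 2) / (2 * s) + s / 2 * l := by
          rw [integral_add (hint.div_const _) (integrable_const _), integral_div]
          simp [hl.le, mul_comm]
      _ ≤ s ^ 2 / (2 * s) + s / 2 * 1 := by
          gcongr
          refine (setIntegral_mono_set (hu.integrableOn_deriv_sq a)
            (ae_of_all _ fun _ => sq_nonneg _) hc.eventuallyLE).trans ?_
          linarith [integral_deriv_sq_le_dirichlet u a]
      _ = s := by field_simp; norm_num
  rw [onEdge_apply _ _ _ x.2] at h2
  have h3 := abs_sub_abs_le_abs_sub (u (G.pt a x)) (G.onEdge u a z)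
  linarith

end Fintype

end MetricGraph

/-! ### The action of a function, and counting its branches -/

namespace MetricGraph

variable {V B H : Type*} {G : MetricGraph V B H}

lemma onEdge_zero (u : G.Pt → ℝ) (b : B) :
    G.onEdge u (Sum.inl b) 0 = u (G.vtx (G.src b)) := by
  rw [onEdge_apply _ _ _ (G.zero_mem_dom _), G.pt_src]

lemma onEdge_len (u : G.Pt → ℝ) (b : B) :
    G.onEdge u (Sum.inl b) (G.len b) = u (G.vtx (G.tgt b)) := by
  rw [onEdge_apply _ _ _ (G.len_mem_dom b), G.pt_tgt]

/-- The action of `u` on the edge `a`, for the calibration with peak `M`. -/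
noncomputable def action (p M : ℝ) (u : G.Pt → ℝ) (a : B ⊕ H) : ℝ :=
  ∫ x in G.dom a, actionDensity p M (G.onEdge u a) x

lemma action_nonneg (p M : ℝ) (u : G.Pt → ℝ) (a : B ⊕ H) : 0 ≤ action p M u a :=
  integral_nonneg fun _ => actionDensity_nonneg _ _ _ _

lemma abs_onEdge_le {u : G.Pt → ℝ} {M : ℝ} (hM : ∀ P, |u P| ≤ M) {a : B ⊕ H} {x : ℝ}
    (hx : x ∈ G.dom a) : |G.onEdge u a x| ≤ M := by
  rw [onEdge_apply _ _ _ hx]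
  exact hM _

lemma MemH1.integrableOn_rpow {u : G.Pt → ℝ} (hu : G.MemH1 u) {p M : ℝ} (hp : 2 < p)
    (hM : ∀ P, |u P| ≤ M) (a : B ⊕ H) :
    IntegrableOn (fun x => |G.onEdge u a x| ^ p) (G.dom a) := by
  refine Integrable.mono' ((hu.integrableOn_sq a).const_mul (M ^ (p - 2))) ?_ ?_
  · exact ((continuous_abs.rpow_const fun _ => Or.inr (by linarith)).comp_aestronglyMeasurable
      (hu a).2.1.aestronglyMeasurable)
  · rw [ae_restrict_iff' (G.measurableSet_dom a)]
    refine ae_of_all _ fun x hx => ?_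
    have h := calib_sq hp (abs_onEdge_le hM hx)
    have h2 := sq_nonneg (calib p M (G.onEdge u a x))
    rw [h] at h2
    have h3 : 0 < 2 / p := by positivity
    rw [Real.norm_of_nonneg (by positivity)]
    have := nonneg_of_mul_nonneg_right h2 h3
    linarith

lemma actionDensity_eq {u : G.Pt → ℝ} {p M : ℝ} (hp : 2 < p) (hM : ∀ P, |u P| ≤ M) {a : B ⊕ H}
    {x : ℝ} (hx : x ∈ G.dom a) :
    actionDensity p M (G.onEdge u a) x = 1 / 2 * deriv (G.onEdge u a) x ^ 2 +
      (M ^ (p - 2) / p * G.onEdge u a x ^ 2 - 1 / p * |G.onEdge u a x| ^ p) := by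
  unfold actionDensity
  rw [calib_sq hp (abs_onEdge_le hM hx)]
  ring

lemma MemH1.integrableOn_actionDensity {u : G.Pt → ℝ} (hu : G.MemH1 u) {p M : ℝ} (hp : 2 < p)
    (hM : ∀ P, |u P| ≤ M) (a : B ⊕ H) :
    IntegrableOn (actionDensity p M (G.onEdge u a)) (G.dom a) :=
  (integrableOn_congr_fun (fun _ hx => actionDensity_eq hp hM hx) (G.measurableSet_dom a)).2
    (((hu.integrableOn_deriv_sq a).const_mul _).add (((hu.integrableOn_sq a).const_mul _).sub
      ((hu.integrableOn_rpow hp hM a).const_mul _)))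

/-- The multiplier M^(p-2)/p is exactly what completes the potential -|u|^p/p to the square
Φ'(u)²/2, which is possible because |u| never exceeds M. -/
lemma MemH1.energy_add_eq [Fintype B] [Fintype H] {u : G.Pt → ℝ} (hu : G.MemH1 u) {p M : ℝ}
    (hp : 2 < p) (hM : ∀ P, |u P| ≤ M) :
    G.energy p u + M ^ (p - 2) / p * G.mass u = ∑ a, action p M u a := by
  have h : ∀ a, action p M u a = 1 / 2 * (∫ x in G.dom a, deriv (G.onEdge u a) x ^ 2) +
      (M ^ (p - 2) / p * (∫ x in G.dom a, G.onEdge u a x ^ 2) -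
        1 / p * ∫ x in G.dom a, |G.onEdge u a x| ^ p) := by
    intro a
    have i1 := (hu.integrableOn_deriv_sq a).const_mul (1 / 2)
    have i2 := (hu.integrableOn_sq a).const_mul (M ^ (p - 2) / p)
    have i3 := (hu.integrableOn_rpow hp hM a).const_mul (1 / p)
    have i23 : IntegrableOn (fun x => M ^ (p - 2) / p * G.onEdge u a x ^ 2 -
        1 / p * |G.onEdge u a x| ^ p) (G.dom a) := i2.sub i3
    unfold action
    rw [setIntegral_congr_fun (G.measurableSet_dom a) (fun x hx => actionDensity_eq hp hM hx),
      integral_add i1 i23, integral_sub i2 i3, integral_const_mul, integral_const_mul,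
      integral_const_mul]
  simp only [h, Finset.sum_add_distrib, Finset.sum_sub_distrib, ← Finset.mul_sum]
  unfold energy mass dirichlet
  ring

/-- Three consecutive increments are enough for all later counts: a loop needs end, peak, low point,
end; the other cases use degenerate pieces. -/
lemma MemH1.variation_le_action {u : G.Pt → ℝ} (hu : G.MemH1 u) {p M : ℝ} (hp : 2 < p)
    (hM : ∀ P, |u P| ≤ M) {a : B ⊕ H} {x y z w : ℝ} (hx : x ∈ G.dom a) (hw : w ∈ G.dom a)
    (hxy : x ≤ y) (hyz : y ≤ z) (hzw : z ≤ w) :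
    |calibInt p M (G.onEdge u a y) - calibInt p M (G.onEdge u a x)| +
      |calibInt p M (G.onEdge u a z) - calibInt p M (G.onEdge u a y)| +
      |calibInt p M (G.onEdge u a w) - calibInt p M (G.onEdge u a z)| ≤ action p M u a := by
  have hy : y ∈ G.dom a := (G.ordConnected_dom a).out hx hw ⟨hxy, hyz.trans hzw⟩
  have hz : z ∈ G.dom a := (G.ordConnected_dom a).out hx hw ⟨hxy.trans hyz, hzw⟩
  have key : ∀ s ∈ G.dom a, ∀ t ∈ G.dom a, s ≤ t →
      |calibInt p M (G.onEdge u a t) - calibInt p M (G.onEdge u a s)| ≤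
        (∫ r in s..t, actionDensity p M (G.onEdge u a) r) ∧
      IntervalIntegrable (actionDensity p M (G.onEdge u a)) volume s t := by
    intro s hs t ht hst
    have hsub : Icc s t ⊆ G.dom a := (G.ordConnected_dom a).out hs ht
    refine ⟨abs_calibInt_sub_le hp hst (hu.absolutelyContinuous hs ht)
      ((hu.integrableOn_deriv_sq a).mono_set hsub), ?_⟩
    rw [intervalIntegrable_iff_integrableOn_Icc_of_le hst]
    exact (hu.integrableOn_actionDensity hp hM a).mono_set hsub
  obtain ⟨h1, i1⟩ := key x hx y hy hxy
  obtain ⟨h2, i2⟩ := key y hy z hz hyz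
  obtain ⟨h3, i3⟩ := key z hz w hw hzw
  refine (add_le_add (add_le_add h1 h2) h3).trans ?_
  rw [intervalIntegral.integral_add_adjacent_intervals i1 i2,
    intervalIntegral.integral_add_adjacent_intervals (i1.trans i2) i3,
    intervalIntegral.integral_of_le (hxy.trans (hyz.trans hzw))]
  exact setIntegral_mono_set (hu.integrableOn_actionDensity hp hM a)
    (ae_of_all _ fun _ => actionDensity_nonneg _ _ _ _)
    (Ioc_subset_Icc_self.trans ((G.ordConnected_dom a).out hx hw)).eventuallyLE

lemma MemH1.sub_le_action {u : G.Pt → ℝ} (hu : G.MemH1 u) {p M : ℝ} (hp : 2 < p)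
    (hM : ∀ P, |u P| ≤ M) {a : B ⊕ H} {x z : ℝ} (hx : x ∈ G.dom a) (hz : z ∈ G.dom a) :
    calibInt p M (G.onEdge u a x) - calibInt p M (G.onEdge u a z) ≤ action p M u a := by
  rcases le_total x z with h | h
  · have := hu.variation_le_action hp hM hx hz le_rfl le_rfl h
    simp only [sub_self, abs_zero, zero_add] at this
    exact (le_abs_self _).trans ((abs_sub_comm _ _).le.trans this)
  · have := hu.variation_le_action hp hM hz hx le_rfl le_rfl h
    simp only [sub_self, abs_zero, zero_add] at this
    exact (le_abs_self _).trans this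

/-- `|u|` takes a value at most `δ` on every edge. -/
def LowOnEdges (u : G.Pt → ℝ) (δ : ℝ) : Prop :=
  ∀ a : B ⊕ H, ∃ z ∈ G.dom a, |G.onEdge u a z| ≤ δ

lemma MemH1.lowOnEdges [Fintype B] [Fintype H] {u : G.Pt → ℝ} (hu : G.MemH1 u) {l : ℝ}
    (hl : 0 < l) (hlen : ∀ b, l ≤ G.len b) : LowOnEdges u (√(G.mass u / l)) := by
  intro a
  obtain ⟨c, -, hc⟩ := exists_Icc_subset_dom hl hlen (G.zero_mem_dom a)
  obtain ⟨z, hz, h⟩ := hu.exists_mul_sq_le_mass hl hc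
  refine ⟨z, hc hz, Real.abs_le_sqrt ?_⟩
  rw [le_div_iff₀ hl]
  linarith

/-- The supremum of `|u|` on the edge `a` is at least `M`. -/
def PeaksOn (u : G.Pt → ℝ) (M : ℝ) (a : B ⊕ H) : Prop :=
  ∀ t < M, ∃ x ∈ G.dom a, t < |G.onEdge u a x|

lemma MemH1.sub_le_action_of_low {u : G.Pt → ℝ} (hu : G.MemH1 u) {p M δ : ℝ} (hp : 2 < p)
    (hM : ∀ P, |u P| ≤ M) (hδ : LowOnEdges u δ) {a : B ⊕ H} {x : ℝ} (hx : x ∈ G.dom a) :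
    calibInt p M (G.onEdge u a x) - calibInt p M δ ≤ action p M u a := by
  obtain ⟨z, hz, h⟩ := hδ a
  have h1 := hu.sub_le_action hp hM hx hz
  have h2 := calibInt_le_of_abs_le hp M h
  linarith

/-- The cost of one branch. The supremum is not assumed to be attained on the edge, which may be a
halfline, so the estimate is proved for levels t < M and passed to the limit. -/
lemma MemH1.sub_le_action_of_peaksOn {u : G.Pt → ℝ} (hu : G.MemH1 u) {p M δ : ℝ} (hp : 2 < p)
    (hM : ∀ P, |u P| ≤ M) (hδ : LowOnEdges u δ) (hM0 : 0 ≤ M) {a : B ⊕ H}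
    (ha : PeaksOn u M a) : calibInt p M M - calibInt p M δ ≤ action p M u a := by
  rcases hM0.eq_or_lt with rfl | hM0
  · have := calibInt_nonneg hp 0 δ
    have := action_nonneg p 0 u a
    rw [calibInt_zero]
    linarith
  have h : Filter.Tendsto (fun t => calibInt p M t - calibInt p M δ) (nhdsWithin M (Iio M))
      (nhds (calibInt p M M - calibInt p M δ)) :=
    (((continuous_calibInt hp M).tendsto M).sub_const _).mono_left nhdsWithin_le_nhds
  refine le_of_tendsto h ?_
  filter_upwards [Ioo_mem_nhdsLT hM0] with t ht
  obtain ⟨x, hx, hxt⟩ := ha t ht.2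
  have h1 := hu.sub_le_action_of_low hp hM hδ hx
  have h2 := calibInt_mono hp M ht.1.le hxt.le
  rw [calibInt_abs] at h2
  linarith

lemma MemH1.exists_abs_eq_of_peaksOn {u : G.Pt → ℝ} (hu : G.MemH1 u) {M : ℝ}
    (hM : ∀ P, |u P| ≤ M) {b : B} (hb : PeaksOn u M (Sum.inl b : B ⊕ H)) :
    ∃ x ∈ G.dom (Sum.inl b : B ⊕ H), |G.onEdge u (Sum.inl b) x| = M := by
  obtain ⟨x, hx, hmax⟩ := isCompact_Icc.exists_isMaxOn
    (nonempty_Icc.2 (G.len_pos b).le)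
    (hu.continuousOn (G.zero_mem_dom (Sum.inl b)) (G.len_mem_dom b)).abs
  refine ⟨x, hx, le_antisymm (abs_onEdge_le hM hx) ?_⟩
  by_contra! hlt
  obtain ⟨y, hy, h⟩ := hb _ hlt
  exact (hmax hy).not_gt h

/-- From the peak, go one way to a low point and the other way to an end of the edge. Which end is
reached depends on the position of the low point, hence the common bound `S` for both ends; `S` is
paid back later by another edge at that vertex. -/
lemma MemH1.two_mul_sub_le_action {u : G.Pt → ℝ} (hu : G.MemH1 u) {p M δ S : ℝ} (hp : 2 < p)
    (hM : ∀ P, |u P| ≤ M) (hδ : LowOnEdges u δ) {b : B} (hb : PeaksOn u M (Sum.inl b : B ⊕ H))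
    (h0 : calibInt p M (u (G.vtx (G.src b))) ≤ S) (h1 : calibInt p M (u (G.vtx (G.tgt b))) ≤ S) :
    2 * calibInt p M M - S - calibInt p M δ ≤ action p M u (Sum.inl b) := by
  obtain ⟨x, hx, hxM⟩ := hu.exists_abs_eq_of_peaksOn hM hb
  obtain ⟨z, hz, hzδ⟩ := hδ (Sum.inl b)
  have e1 := calibInt_abs p M (G.onEdge u (Sum.inl b) x)
  rw [hxM] at e1
  have e2 := calibInt_le_of_abs_le hp M hzδ
  rw [← onEdge_zero u b] at h0
  rw [← onEdge_len u b] at h1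
  rcases le_total x z with h | h
  · have := hu.variation_le_action hp hM (G.zero_mem_dom _) hz hx.1 h le_rfl
    have h3 := abs_nonneg (calibInt p M (G.onEdge u (Sum.inl b) z) -
      calibInt p M (G.onEdge u (Sum.inl b) z))
    have h4 := le_abs_self (calibInt p M (G.onEdge u (Sum.inl b) x) -
      calibInt p M (G.onEdge u (Sum.inl b) 0))
    have h5 := neg_le_abs (calibInt p M (G.onEdge u (Sum.inl b) z) -
      calibInt p M (G.onEdge u (Sum.inl b) x))
    linarith
  · have := hu.variation_le_action hp hM hz (G.len_mem_dom b) le_rfl h hx.2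
    have h3 := abs_nonneg (calibInt p M (G.onEdge u (Sum.inl b) z) -
      calibInt p M (G.onEdge u (Sum.inl b) z))
    have h4 := le_abs_self (calibInt p M (G.onEdge u (Sum.inl b) x) -
      calibInt p M (G.onEdge u (Sum.inl b) z))
    have h5 := neg_le_abs (calibInt p M (G.onEdge u (Sum.inl b) (G.len b)) -
      calibInt p M (G.onEdge u (Sum.inl b) x))
    linarith

/-- On a circle a high point and a low point are joined by two disjoint arcs, each of which costs
one branch. The arc through the vertex is split there into two increments. -/
lemma MemH1.two_mul_sub_le_action_of_loop {u : G.Pt → ℝ} (hu : G.MemH1 u) {p M δ : ℝ}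
    (hp : 2 < p) (hM : ∀ P, |u P| ≤ M) (hδ : LowOnEdges u δ) {b : B} (hl : G.src b = G.tgt b)
    {x : ℝ} (hx : x ∈ G.dom (Sum.inl b : B ⊕ H)) :
    2 * (calibInt p M (G.onEdge u (Sum.inl b) x) - calibInt p M δ) ≤
      action p M u (Sum.inl b) := by
  obtain ⟨z, hz, hzδ⟩ := hδ (Sum.inl b)
  have e2 := calibInt_le_of_abs_le hp M hzδ
  have e : G.onEdge u (Sum.inl b) 0 = G.onEdge u (Sum.inl b) (G.len b) := by
    rw [onEdge_zero, onEdge_len, hl]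
  rcases le_total x z with h | h
  · have := hu.variation_le_action hp hM (G.zero_mem_dom _) (G.len_mem_dom b) hx.1 h hz.2
    rw [e] at this
    have h3 := le_abs_self (calibInt p M (G.onEdge u (Sum.inl b) (G.len b)) -
      calibInt p M (G.onEdge u (Sum.inl b) z))
    have h4 := le_abs_self (calibInt p M (G.onEdge u (Sum.inl b) x) -
      calibInt p M (G.onEdge u (Sum.inl b) (G.len b)))
    have h5 := neg_le_abs (calibInt p M (G.onEdge u (Sum.inl b) z) -
      calibInt p M (G.onEdge u (Sum.inl b) x))
    linarith
  · have := hu.variation_le_action hp hM (G.zero_mem_dom _) (G.len_mem_dom b) hz.1 h hx.2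
    rw [e] at this
    have h3 := neg_le_abs (calibInt p M (G.onEdge u (Sum.inl b) z) -
      calibInt p M (G.onEdge u (Sum.inl b) (G.len b)))
    have h4 := le_abs_self (calibInt p M (G.onEdge u (Sum.inl b) x) -
      calibInt p M (G.onEdge u (Sum.inl b) z))
    have h5 := neg_le_abs (calibInt p M (G.onEdge u (Sum.inl b) (G.len b)) -
      calibInt p M (G.onEdge u (Sum.inl b) x))
    linarith

lemma MemH1.sub_le_action_of_incident {u : G.Pt → ℝ} (hu : G.MemH1 u) {p M δ : ℝ} (hp : 2 < p)
    (hM : ∀ P, |u P| ≤ M) (hδ : LowOnEdges u δ) {a : B ⊕ H} {y : V} (hy : G.Incident a y) :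
    calibInt p M (u (G.vtx y)) - calibInt p M δ ≤ action p M u a := by
  obtain ⟨x, hx⟩ := hy
  have := hu.sub_le_action_of_low hp hM hδ x.2
  rwa [onEdge_apply _ _ _ x.2, Subtype.coe_eta, hx] at this

/-- At an endpoint of degree at least `3` of the non-loop edge `e`, either there is a loop, or two
other edges end there. -/
lemma exists_incident_of_three_le_degree [Finite B] [Finite H] {e : B} (he : G.src e ≠ G.tgt e)
    {y : V} (hdeg : 3 ≤ G.degree y) :
    (∃ b ≠ e, G.src b = y ∧ G.tgt b = y) ∨ ∃ a₁ a₂ : B ⊕ H, a₁ ≠ a₂ ∧ a₁ ≠ Sum.inl e ∧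
      a₂ ≠ Sum.inl e ∧ G.Incident a₁ y ∧ G.Incident a₂ y := by
  classical
  by_cases hloop : ∃ b, G.src b = y ∧ G.tgt b = y
  · obtain ⟨b, h1, h2⟩ := hloop
    refine Or.inl ⟨b, ?_, h1, h2⟩
    rintro rfl
    exact he (h1.trans h2.symm)
  · right
    -- `X` is the set of edge ends at `y`. Without a loop at `y`, distinct ends belong to distinct
    -- edges, so at least three edges end at `y`, two of which are not `e`.
    let X := ({b : B // G.src b = y} ⊕ {b : B // G.tgt b = y}) ⊕ {h : H // G.base h = y}
    have hX : Nat.card X = G.degree y := by simp [X, Nat.card_sum, degree]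
    let φ : X → B ⊕ H :=
      Sum.elim (Sum.elim (fun b => Sum.inl b.1) fun b => Sum.inl b.1) fun h => Sum.inr h.1
    have hφ : Function.Injective φ := by
      rintro ((⟨b, hb⟩ | ⟨b, hb⟩) | ⟨b, hb⟩) ((⟨c, hc⟩ | ⟨c, hc⟩) | ⟨c, hc⟩) h <;>
        simp only [φ, Sum.elim_inl, Sum.elim_inr, Sum.inl.injEq, Sum.inr.injEq, reduceCtorEq] at h
      · subst h; rfl
      · exact (hloop ⟨b, hb, h ▸ hc⟩).elim
      · exact (hloop ⟨b, h ▸ hc, hb⟩).elim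
      · subst h; rfl
      · subst h; rfl
    have hinc : ∀ x, G.Incident (φ x) y := by
      rintro ((⟨b, rfl⟩ | ⟨b, rfl⟩) | ⟨b, rfl⟩)
      · exact G.incident_src b
      · exact G.incident_tgt b
      · exact G.incident_base b
    have := Fintype.ofFinite X
    have hcard : 3 ≤ (Finset.univ.image φ).card := by
      rw [Finset.card_image_of_injective _ hφ, Finset.card_univ, ← Nat.card_eq_fintype_card, hX]
      exact hdeg
    have h2 : 1 < ((Finset.univ.image φ).erase (Sum.inl e)).card := by
      have := Finset.pred_card_le_card_erase (s := Finset.univ.image φ) (a := Sum.inl e)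
      omega
    obtain ⟨a₁, h₁, a₂, h₂, hne⟩ := Finset.one_lt_card.1 h2
    simp only [Finset.mem_erase, Finset.mem_image, Finset.mem_univ, true_and] at h₁ h₂
    obtain ⟨h₁, x₁, rfl⟩ := h₁
    obtain ⟨h₂, x₂, rfl⟩ := h₂
    exact ⟨_, _, hne, h₁, h₂, hinc _, hinc _⟩

section Fintype

variable [Fintype B] [Fintype H]

lemma add_le_sum_action (p M : ℝ) (u : G.Pt → ℝ) {a b : B ⊕ H} (h : a ≠ b) :
    action p M u a + action p M u b ≤ ∑ c, action p M u c := by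
  classical
  rw [← Finset.sum_pair h]
  exact Finset.sum_le_univ_sum_of_nonneg fun _ => action_nonneg _ _ _ _

lemma add_add_le_sum_action (p M : ℝ) (u : G.Pt → ℝ) {a b c : B ⊕ H} (h₁ : a ≠ b) (h₂ : a ≠ c)
    (h₃ : b ≠ c) : action p M u a + action p M u b + action p M u c ≤ ∑ d, action p M u d := by
  classical
  have : ∑ d ∈ {a, b, c}, action p M u d =
      action p M u a + (action p M u b + action p M u c) := by
    rw [Finset.sum_insert (by simp [h₁, h₂]), Finset.sum_pair h₃]
  rw [add_assoc, ← this]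
  exact Finset.sum_le_univ_sum_of_nonneg fun _ => action_nonneg _ _ _ _

lemma MemH1.two_mul_le_sum_action {u : G.Pt → ℝ} (hu : G.MemH1 u) {p M δ : ℝ} (hp : 2 < p)
    (hM : ∀ P, |u P| ≤ M) (hM0 : 0 ≤ M) (hδ : LowOnEdges u δ) {a b : B ⊕ H} (hab : a ≠ b)
    (ha : PeaksOn u M a) (hb : PeaksOn u M b) :
    2 * (calibInt p M M - calibInt p M δ) ≤ ∑ c, action p M u c := by
  have h1 := hu.sub_le_action_of_peaksOn hp hM hδ hM0 ha
  have h2 := hu.sub_le_action_of_peaksOn hp hM hδ hM0 hb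
  linarith [add_le_sum_action p M u hab]

/-- One branch comes from `f`, and two from `e` if it is a loop. Otherwise take the end `y` of `e`
with the larger value of Φ(u): `e` gives 2Φ(M) - Φ(u(y)) - Φ(δ), and a further edge at `y` gives
Φ(u(y)) - Φ(δ), so the vertex value cancels. Degree at least 3 provides this further edge, or a
loop. -/
lemma MemH1.three_mul_le_sum_action {u : G.Pt → ℝ} (hu : G.MemH1 u) {p M δ : ℝ} (hp : 2 < p)
    (hM : ∀ P, |u P| ≤ M) (hM0 : 0 ≤ M) (hδ : LowOnEdges u δ) {e : B} {f : B ⊕ H}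
    (hs : 3 ≤ G.degree (G.src e)) (ht : 3 ≤ G.degree (G.tgt e)) (hf : f ≠ Sum.inl e)
    (hpe : PeaksOn u M (Sum.inl e : B ⊕ H)) (hpf : PeaksOn u M f) :
    3 * (calibInt p M M - calibInt p M δ) ≤ ∑ c, action p M u c := by
  have hJf := hu.sub_le_action_of_peaksOn hp hM hδ hM0 hpf
  obtain ⟨x, hx, hxM⟩ := hu.exists_abs_eq_of_peaksOn hM hpe
  by_cases he : G.src e = G.tgt e
  · have h1 := hu.two_mul_sub_le_action_of_loop hp hM hδ he hx
    rw [← calibInt_abs, hxM] at h1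
    linarith [add_le_sum_action p M u hf]
  obtain ⟨y, hy, h0, h1⟩ : ∃ y, 3 ≤ G.degree y ∧
      calibInt p M (u (G.vtx (G.src e))) ≤ calibInt p M (u (G.vtx y)) ∧
      calibInt p M (u (G.vtx (G.tgt e))) ≤ calibInt p M (u (G.vtx y)) := by
    rcases le_total (calibInt p M (u (G.vtx (G.src e)))) (calibInt p M (u (G.vtx (G.tgt e))))
      with h | h
    · exact ⟨_, ht, h, le_rfl⟩
    · exact ⟨_, hs, le_rfl, h⟩
  have hJe := hu.two_mul_sub_le_action hp hM hδ hpe h0 h1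
  have third : ∀ g : B ⊕ H, g ≠ Sum.inl e → g ≠ f → G.Incident g y →
      3 * (calibInt p M M - calibInt p M δ) ≤ ∑ c, action p M u c := by
    intro g hge hgf hg
    have := hu.sub_le_action_of_incident hp hM hδ hg
    linarith [add_add_le_sum_action p M u hf.symm hge.symm hgf.symm]
  rcases exists_incident_of_three_le_degree he hy with ⟨b, hbe, hb0, hb1⟩ | ⟨a₁, a₂, h, h₁, h₂, i₁, i₂⟩
  -- If the loop at `y` is `f` itself, there may be no third edge; the loop then carries two
  -- branches, and `e` keeps one because Φ(u(y)) ≤ Φ(M).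
  · by_cases hbf : Sum.inl b = f
    · subst hbf
      obtain ⟨w, hw, hwM⟩ := hu.exists_abs_eq_of_peaksOn hM hpf
      have h2 := hu.two_mul_sub_le_action_of_loop hp hM hδ (hb0.trans hb1.symm) hw
      rw [← calibInt_abs, hwM] at h2
      have h3 := calibInt_le_of_abs_le hp M (hM (G.vtx y))
      linarith [add_le_sum_action p M u hf]
    · exact third _ (fun h => hbe (Sum.inl_injective h)) hbf (hb0 ▸ G.incident_src b)
  · by_cases h1f : a₁ = f
    · exact third a₂ h₂ (fun h' => h (h1f.trans h'.symm)) i₂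
    · exact third a₁ h₁ h1f i₁

end Fintype

end MetricGraph

/-! ### The soliton and its integrals -/

/-- The soliton with peak `1`. -/
noncomputable def soliton (p y : ℝ) : ℝ :=
  Real.cosh (√(2 / p) * ((p - 2) / 2) * y) ^ (-(2 / (p - 2)))

/-- The derivative of the soliton. -/
noncomputable def solitonDeriv (p y : ℝ) : ℝ :=
  -(√(2 / p) * soliton p y * Real.tanh (√(2 / p) * ((p - 2) / 2) * y))

lemma soliton_pos (p y : ℝ) : 0 < soliton p y := Real.rpow_pos_of_pos (Real.cosh_pos _) _

lemma soliton_neg (p y : ℝ) : soliton p (-y) = soliton p y := by simp [soliton]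

lemma soliton_zero (p : ℝ) : soliton p 0 = 1 := by simp [soliton]

lemma soliton_le_one {p : ℝ} (hp : 2 < p) (y : ℝ) : soliton p y ≤ 1 :=
  Real.rpow_le_one_of_one_le_of_nonpos (Real.one_le_cosh _)
    (neg_nonpos.2 (div_nonneg zero_le_two (by linarith)))

lemma hasDerivAt_soliton {p : ℝ} (hp : 2 < p) (y : ℝ) :
    HasDerivAt (soliton p) (solitonDeriv p y) y := by
  have hp' : p - 2 ≠ 0 := by linarith
  have h1 : HasDerivAt (fun y : ℝ => √(2 / p) * ((p - 2) / 2) * y) (√(2 / p) * ((p - 2) / 2)) y := by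
    simpa using (hasDerivAt_id y).const_mul (√(2 / p) * ((p - 2) / 2))
  have h := h1.cosh.rpow_const (p := -(2 / (p - 2))) (Or.inl (Real.cosh_pos _).ne')
  refine HasDerivAt.congr_deriv (f := soliton p) h ?_
  have hc := Real.cosh_pos (√(2 / p) * ((p - 2) / 2) * y)
  unfold solitonDeriv soliton
  rw [Real.rpow_sub_one hc.ne', Real.tanh_eq_sinh_div_cosh]
  field_simp

lemma soliton_rpow_sub_two {p : ℝ} (hp : 2 < p) (y : ℝ) :
    soliton p y ^ (p - 2) = 1 - Real.tanh (√(2 / p) * ((p - 2) / 2) * y) ^ 2 := by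
  have hp' : p - 2 ≠ 0 := by linarith
  have hc := Real.cosh_pos (√(2 / p) * ((p - 2) / 2) * y)
  unfold soliton
  rw [← Real.rpow_mul hc.le, show -(2 / (p - 2)) * (p - 2) = -(2 : ℕ) by push_cast; field_simp,
    Real.rpow_neg hc.le, Real.rpow_natCast, Real.tanh_eq_sinh_div_cosh, div_pow, Real.sinh_sq]
  field_simp
  ring

lemma soliton_rpow {p : ℝ} (y : ℝ) :
    soliton p y ^ p = soliton p y ^ 2 * soliton p y ^ (p - 2) := by
  rw [← Real.rpow_natCast, ← Real.rpow_add (soliton_pos p y)]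
  norm_num

lemma solitonDeriv_sq {p : ℝ} (hp : 2 < p) (y : ℝ) :
    solitonDeriv p y ^ 2 = 2 / p * (soliton p y ^ 2 - soliton p y ^ p) := by
  rw [soliton_rpow, soliton_rpow_sub_two hp]
  unfold solitonDeriv
  rw [neg_sq, mul_pow, mul_pow, Real.sq_sqrt (by positivity)]
  ring

lemma hasDerivAt_solitonDeriv {p : ℝ} (hp : 2 < p) (y : ℝ) :
    HasDerivAt (solitonDeriv p)
      (2 / p * soliton p y - soliton p y * soliton p y ^ (p - 2)) y := by
  set κ := √(2 / p) * ((p - 2) / 2) with hκ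
  have hc : ∀ z, Real.cosh z ≠ 0 := fun z => (Real.cosh_pos z).ne'
  have h1 : HasDerivAt (fun y : ℝ => κ * y) κ y := by
    simpa using (hasDerivAt_id y).const_mul κ
  have h2 : HasDerivAt (fun y : ℝ => Real.tanh (κ * y)) (κ * (1 - Real.tanh (κ * y) ^ 2)) y := by
    have := h1.sinh.div h1.cosh (hc (κ * y))
    refine (this.congr_of_eventuallyEq (Filter.Eventually.of_forall fun z =>
      Real.tanh_eq_sinh_div_cosh _)).congr_deriv ?_
    rw [Real.tanh_eq_sinh_div_cosh]
    have := hc (κ * y)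
    field_simp
  have h3 := (((hasDerivAt_soliton hp y).const_mul √(2 / p)).mul h2).neg
  refine h3.congr_deriv ?_
  have hs : √(2 / p) * √(2 / p) = 2 / p := Real.mul_self_sqrt (by positivity)
  have hp0 : p ≠ 0 := by linarith
  have e := soliton_rpow_sub_two hp y
  rw [← hκ] at e
  rw [e]
  unfold solitonDeriv
  rw [← hκ]
  set T := Real.tanh (κ * y)
  calc _ = √(2 / p) * √(2 / p) * soliton p y * T ^ 2 -
        √(2 / p) * √(2 / p) * ((p - 2) / 2) * soliton p y * (1 - T ^ 2) := by
          rw [hκ]; ring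
    _ = _ := by rw [hs]; field_simp; ring

lemma soliton_le_exp {p : ℝ} (hp : 2 < p) (y : ℝ) :
    soliton p y ≤ 2 ^ (2 / (p - 2)) * Real.exp (-√(2 / p) * y) := by
  have hp' : p - 2 ≠ 0 := by linarith
  have hp2 : 0 < p - 2 := by linarith
  set κ := √(2 / p) * ((p - 2) / 2) with hκ
  have h : Real.exp (κ * y) / 2 ≤ Real.cosh (κ * y) := by
    rw [Real.cosh_eq]
    have := Real.exp_pos (-(κ * y))
    linarith
  refine (Real.rpow_le_rpow_of_nonpos (by positivity) h
    (neg_nonpos.2 (by positivity))).trans_eq ?_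
  rw [Real.div_rpow (Real.exp_pos _).le zero_le_two, ← Real.exp_mul, Real.rpow_neg zero_le_two,
    div_inv_eq_mul, mul_comm, show κ * y * -(2 / (p - 2)) = -√(2 / p) * y by
      rw [hκ]; field_simp]

lemma tendsto_soliton {p : ℝ} (hp : 2 < p) :
    Filter.Tendsto (soliton p) Filter.atTop (nhds 0) := by
  have hs : 0 < √(2 / p) := Real.sqrt_pos.2 (by positivity)
  have h : Filter.Tendsto (fun y => (2 : ℝ) ^ (2 / (p - 2)) * Real.exp (-√(2 / p) * y))
      Filter.atTop (nhds ((2 : ℝ) ^ (2 / (p - 2)) * 0)) :=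
    (Real.tendsto_exp_atBot.comp
      (Filter.tendsto_id.const_mul_atTop_of_neg (neg_neg_of_pos hs))).const_mul _
  rw [mul_zero] at h
  exact squeeze_zero (fun y => (soliton_pos p y).le) (soliton_le_exp hp) h

lemma continuous_soliton {p : ℝ} (hp : 2 < p) : Continuous (soliton p) :=
  continuous_iff_continuousAt.2 fun y => (hasDerivAt_soliton hp y).continuousAt

lemma continuous_solitonDeriv {p : ℝ} (hp : 2 < p) : Continuous (solitonDeriv p) :=
  continuous_iff_continuousAt.2 fun y => (hasDerivAt_solitonDeriv hp y).continuousAt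

lemma integrableOn_soliton_sq {p : ℝ} (hp : 2 < p) :
    IntegrableOn (fun y => soliton p y ^ 2) (Ioi 0) := by
  have hs : 0 < √(2 / p) := Real.sqrt_pos.2 (by positivity)
  refine Integrable.mono' ((integrableOn_exp_mul_Ioi (neg_neg_of_pos hs) 0).const_mul
    (2 ^ (2 / (p - 2)))) ((continuous_soliton hp).pow 2).aestronglyMeasurable
    (ae_of_all _ fun y => ?_)
  rw [Real.norm_of_nonneg (sq_nonneg _), sq]
  exact (mul_le_of_le_one_right (soliton_pos p y).le (soliton_le_one hp y)).trans
    (soliton_le_exp hp y)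

lemma soliton_rpow_le {p : ℝ} (hp : 2 < p) (y : ℝ) : soliton p y ^ p ≤ soliton p y ^ 2 := by
  rw [← Real.rpow_natCast]
  exact Real.rpow_le_rpow_of_exponent_ge (soliton_pos p y) (soliton_le_one hp y) (by norm_num; linarith)

lemma integrableOn_soliton_rpow {p : ℝ} (hp : 2 < p) :
    IntegrableOn (fun y => soliton p y ^ p) (Ioi 0) := by
  refine Integrable.mono' (integrableOn_soliton_sq hp)
    ((continuous_soliton hp).rpow_const fun _ => Or.inr (by linarith)).aestronglyMeasurable
    (ae_of_all _ fun y => ?_)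
  rw [Real.norm_of_nonneg (Real.rpow_nonneg (soliton_pos p y).le _)]
  exact soliton_rpow_le hp y

lemma integrableOn_solitonDeriv_sq {p : ℝ} (hp : 2 < p) :
    IntegrableOn (fun y => solitonDeriv p y ^ 2) (Ioi 0) := by
  simp only [solitonDeriv_sq hp]
  exact ((integrableOn_soliton_sq hp).sub (integrableOn_soliton_rpow hp)).const_mul _

lemma integral_solitonDeriv_sq_eq {p : ℝ} (hp : 2 < p) :
    ∫ y in Ioi 0, solitonDeriv p y ^ 2 =
      2 / p * ((∫ y in Ioi 0, soliton p y ^ 2) - ∫ y in Ioi 0, soliton p y ^ p) := by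
  simp only [solitonDeriv_sq hp]
  rw [integral_const_mul, integral_sub (integrableOn_soliton_sq hp) (integrableOn_soliton_rpow hp)]

/-- Equality case of the calibration: on the decreasing half φ' = -Φ'(φ) with Φ = `calibInt p 1`, so
φ'² is minus the derivative of Φ(φ), and Φ(φ) runs from Φ(1) to 0. -/
lemma integral_solitonDeriv_sq {p : ℝ} (hp : 2 < p) :
    ∫ y in Ioi 0, solitonDeriv p y ^ 2 = calibInt p 1 1 := by
  have hd : ∀ y ∈ Ioi (0 : ℝ),
      HasDerivAt (fun y => calibInt p 1 (soliton p y)) (-(solitonDeriv p y ^ 2)) y := by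
    intro y hy
    have h := (hasDerivAt_calibInt hp 1 (soliton p y)).comp y (hasDerivAt_soliton hp y)
    refine h.congr_deriv ?_
    have hT : 0 ≤ Real.tanh (√(2 / p) * ((p - 2) / 2) * y) := by
      rw [Real.tanh_eq_sinh_div_cosh]
      refine div_nonneg (Real.sinh_nonneg_iff.2 ?_) (Real.cosh_pos _).le
      have : 0 < p - 2 := by linarith
      have : 0 < y := hy
      positivity
    have e : calib p 1 (soliton p y) = -solitonDeriv p y := by
      unfold calib solitonDeriv
      rw [Real.one_rpow, abs_of_pos (soliton_pos p y), soliton_rpow_sub_two hp, sub_sub_cancel,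
        Real.sqrt_sq hT, neg_neg]
    rw [e]
    ring
  have hcont : Continuous fun y => calibInt p 1 (soliton p y) :=
    (continuous_calibInt hp 1).comp (continuous_soliton hp)
  have hlim : Filter.Tendsto (fun y => calibInt p 1 (soliton p y)) Filter.atTop (nhds 0) := by
    have := ((continuous_calibInt hp 1).tendsto 0).comp (tendsto_soliton hp)
    rwa [calibInt_zero] at this
  have h := integral_Ioi_of_hasDerivAt_of_tendsto hcont.continuousWithinAt hd
    (integrableOn_solitonDeriv_sq hp).neg hlim
  rw [integral_neg, soliton_zero] at h
  linarith

lemma abs_solitonDeriv_le {p : ℝ} (hp : 2 < p) (y : ℝ) : |solitonDeriv p y| ≤ √(2 / p) := by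
  refine Real.abs_le_sqrt ?_
  rw [solitonDeriv_sq hp]
  have h2 : soliton p y ^ 2 ≤ 1 := pow_le_one₀ (soliton_pos p y).le (soliton_le_one hp y)
  have h3 := Real.rpow_pos_of_pos (soliton_pos p y) p
  exact mul_le_of_le_one_right (by positivity) (by linarith)

/-- The soliton equation multiplied by φ and integrated: the integrand is the derivative of φφ',
which vanishes at 0 and at infinity. Together with the first integral φ'² = (2/p)(φ² - φ^p) it
determines the integrals of φ² and φ^p in terms of `calibInt p 1 1`. -/
lemma integral_soliton_pohozaev {p : ℝ} (hp : 2 < p) :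
    (∫ y in Ioi 0, solitonDeriv p y ^ 2) + 2 / p * (∫ y in Ioi 0, soliton p y ^ 2) -
      (∫ y in Ioi 0, soliton p y ^ p) = 0 := by
  have hd : ∀ y ∈ Ioi (0 : ℝ), HasDerivAt (fun y => soliton p y * solitonDeriv p y)
      (solitonDeriv p y ^ 2 + 2 / p * soliton p y ^ 2 - soliton p y ^ p) y := by
    intro y _
    refine ((hasDerivAt_soliton hp y).mul (hasDerivAt_solitonDeriv hp y)).congr_deriv ?_
    rw [soliton_rpow]
    ring
  have hb : ∀ y, |soliton p y * solitonDeriv p y| ≤ √(2 / p) * soliton p y := by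
    intro y
    rw [abs_mul, abs_of_pos (soliton_pos p y), mul_comm]
    exact mul_le_mul_of_nonneg_right (abs_solitonDeriv_le hp y) (soliton_pos p y).le
  have hlim : Filter.Tendsto (fun y => soliton p y * solitonDeriv p y) Filter.atTop (nhds 0) := by
    have := (tendsto_soliton hp).const_mul √(2 / p)
    rw [mul_zero] at this
    exact squeeze_zero_norm hb this
  have i1 := integrableOn_solitonDeriv_sq hp
  have i2 := (integrableOn_soliton_sq hp).const_mul (2 / p)
  have i3 := integrableOn_soliton_rpow hp
  have i12 : IntegrableOn (fun y => solitonDeriv p y ^ 2 + 2 / p * soliton p y ^ 2) (Ioi 0) :=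
    i1.add i2
  have h := integral_Ioi_of_hasDerivAt_of_tendsto
    ((continuous_soliton hp).mul (continuous_solitonDeriv hp)).continuousWithinAt hd
    (i12.sub i3) hlim
  rw [integral_sub i12 i3, integral_add i1 i2, integral_const_mul] at h
  simpa [solitonDeriv] using h

lemma integral_soliton_sq {p : ℝ} (hp : 2 < p) :
    ∫ y in Ioi 0, soliton p y ^ 2 = p * ((p / 2 + 1) / (p - 2)) * calibInt p 1 1 := by
  have h1 := integral_solitonDeriv_sq_eq hp
  have h2 := integral_soliton_pohozaev hp
  rw [integral_solitonDeriv_sq hp] at h1 h2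
  have hp0 : p ≠ 0 := by linarith
  have hp' : p - 2 ≠ 0 := by linarith
  have h3 : (∫ y in Ioi 0, soliton p y ^ p) =
    calibInt p 1 1 + 2 / p * (∫ y in Ioi 0, soliton p y ^ 2) := by linarith
  rw [h3] at h1
  field_simp at h1 ⊢
  linarith

lemma integral_soliton_rpow {p : ℝ} (hp : 2 < p) :
    1 / p * ∫ y in Ioi 0, soliton p y ^ p =
      ((p / 2 + 1) / (p - 2) - 1 / 2) * calibInt p 1 1 := by
  have h1 := integral_solitonDeriv_sq_eq hp
  rw [integral_solitonDeriv_sq hp, integral_soliton_sq hp] at h1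
  have hp0 : p ≠ 0 := by linarith
  have hp' : p - 2 ≠ 0 := by linarith
  field_simp at h1 ⊢
  linarith

/-- No differentiability of `f` is needed, as `deriv` is 0 where it fails. Thus cutting off the
soliton does not increase its Dirichlet integral. -/
lemma abs_deriv_le_of_abs_sub_le {f g : ℝ → ℝ} {g' y : ℝ} (hg : HasDerivAt g g' y)
    (h : ∀ x, |f x - f y| ≤ |g x - g y|) : |deriv f y| ≤ |g'| := by
  refine le_of_forall_pos_le_add fun ε hε => ?_
  refine norm_deriv_le_of_lip' (𝕜 := ℝ) (f := f) (by positivity) ?_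
  filter_upwards [hg.isLittleO.def hε] with x hx
  refine (h x).trans ?_
  simp only [Real.norm_eq_abs, smul_eq_mul] at hx ⊢
  have h1 := abs_sub_abs_le_abs_sub (g x - g y) ((x - y) * g')
  rw [abs_mul] at h1
  linarith

/-! ### Compactly supported profiles -/

/-- The soliton with peak `1`, shifted down by `δ` and cut off at `0`. -/
noncomputable def cutSoliton (p δ y : ℝ) : ℝ := max (soliton p y - δ) 0

lemma cutSoliton_nonneg (p δ y : ℝ) : 0 ≤ cutSoliton p δ y := le_max_right _ _

lemma cutSoliton_neg (p δ y : ℝ) : cutSoliton p δ (-y) = cutSoliton p δ y := by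
  simp [cutSoliton, soliton_neg]

lemma cutSoliton_le (p y : ℝ) {δ : ℝ} (hδ : 0 ≤ δ) : cutSoliton p δ y ≤ soliton p y :=
  max_le (by linarith) (soliton_pos p y).le

lemma abs_cutSoliton_sub_le (p δ x y : ℝ) :
    |cutSoliton p δ x - cutSoliton p δ y| ≤ |soliton p x - soliton p y| := by
  refine (abs_max_sub_max_le_abs _ _ _).trans_eq ?_
  ring_nf

lemma lipschitzWith_cutSoliton {p : ℝ} (hp : 2 < p) (δ : ℝ) :
    LipschitzWith (NNReal.sqrt (2 / p).toNNReal) (cutSoliton p δ) := by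
  have h : LipschitzWith (NNReal.sqrt (2 / p).toNNReal) (soliton p) := by
    refine lipschitzWith_of_nnnorm_deriv_le
      (fun y => (hasDerivAt_soliton hp y).differentiableAt) fun y => ?_
    rw [(hasDerivAt_soliton hp y).deriv, ← NNReal.coe_le_coe]
    simpa [Real.coe_toNNReal _ (show (0 : ℝ) ≤ 2 / p by positivity)] using abs_solitonDeriv_le hp y
  exact LipschitzWith.of_dist_le_mul fun x y =>
    (abs_cutSoliton_sub_le p δ x y).trans (h.dist_le_mul x y)

lemma tendsto_integral_cutSoliton_rpow {p : ℝ} (hp : 2 < p) :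
    Filter.Tendsto (fun n : ℕ => ∫ y in Ioi 0, cutSoliton p (1 / (n + 2)) y ^ p) Filter.atTop
      (nhds (∫ y in Ioi 0, soliton p y ^ p)) := by
  have hδ : Filter.Tendsto (fun n : ℕ => (1 : ℝ) / (n + 2)) Filter.atTop (nhds 0) :=
    Filter.Tendsto.div_atTop tendsto_const_nhds
      (Filter.tendsto_atTop_add_const_right _ _ tendsto_natCast_atTop_atTop)
  refine tendsto_integral_of_dominated_convergence (fun y => soliton p y ^ p) (fun n => ?_)
    (integrableOn_soliton_rpow hp) (fun n => ae_of_all _ fun y => ?_) (ae_of_all _ fun y => ?_)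
  · exact ((lipschitzWith_cutSoliton hp _).continuous.rpow_const fun _ =>
      Or.inr (by linarith)).aestronglyMeasurable
  · rw [Real.norm_of_nonneg (Real.rpow_nonneg (cutSoliton_nonneg _ _ _) _)]
    exact Real.rpow_le_rpow (cutSoliton_nonneg _ _ _) (cutSoliton_le p y (by positivity))
      (by linarith)
  · have h1 : Filter.Tendsto (fun n : ℕ => cutSoliton p (1 / (n + 2)) y) Filter.atTop
        (nhds (max (soliton p y - 0) 0)) := (tendsto_const_nhds.sub hδ).max tendsto_const_nhds
    rw [sub_zero, max_eq_left (soliton_pos p y).le] at h1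
    exact h1.rpow_const (Or.inr (by linarith))

/-- Compactly supported almost minimizers of the energy on the halfline. -/
lemma exists_halfline_profile {p η : ℝ} (hp : 2 < p) (hη : 0 < η) :
    ∃ (h : ℝ → ℝ) (R : ℝ) (K : NNReal), 0 < R ∧ LipschitzWith K h ∧ (∀ y, h (-y) = h y) ∧
      (∀ y, 0 ≤ h y) ∧ (∀ y, R ≤ y → h y = 0) ∧ 0 < ∫ y in (0 : ℝ)..R, h y ^ 2 ∧
      ∫ y in (0 : ℝ)..R, h y ^ 2 ≤ p * ((p / 2 + 1) / (p - 2)) * calibInt p 1 1 ∧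
      1 / 2 * (∫ y in (0 : ℝ)..R, deriv h y ^ 2) - 1 / p * (∫ y in (0 : ℝ)..R, h y ^ p) <
        η - ((p / 2 + 1) / (p - 2) - 1) * calibInt p 1 1 := by
  have hp0 : 0 < p := by linarith
  -- Truncation can only lower the Dirichlet integral, so the whole energy loss is in the potential
  -- term; a loss below p η there is below η after the factor 1/p.
  have hev := (tendsto_integral_cutSoliton_rpow hp).eventually_const_lt
    (show (∫ y in Ioi 0, soliton p y ^ p) - p * η < ∫ y in Ioi 0, soliton p y ^ p by
      linarith [mul_pos hp0 hη])
  obtain ⟨n, hn⟩ := hev.exists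
  -- The shift `n + 2` keeps δ below 1, the height of the soliton, so that the truncated profile is
  -- not zero.
  set δ : ℝ := 1 / (n + 2) with hδ
  have hδ0 : 0 < δ := by positivity
  have hδ1 : δ < 1 := by
    rw [hδ, div_lt_one (by positivity)]
    linarith [(Nat.cast_nonneg n : (0 : ℝ) ≤ n)]
  obtain ⟨R₀, hR₀⟩ := Filter.eventually_atTop.1 ((tendsto_soliton hp).eventually_lt_const hδ0)
  have hR : 0 < max R₀ 1 := lt_max_of_lt_right one_pos
  set R := max R₀ 1
  have hL := lipschitzWith_cutSoliton hp δ
  have hsupp : ∀ y, R ≤ y → cutSoliton p δ y = 0 := fun y hy =>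
    max_eq_right (by linarith [hR₀ y ((le_max_left _ _).trans hy)])
  have hsub : Ioc 0 R ⊆ Ioi (0 : ℝ) := Ioc_subset_Ioi_self
  refine ⟨cutSoliton p δ, R, _, hR, hL, cutSoliton_neg p δ, cutSoliton_nonneg p δ, hsupp, ?_, ?_, ?_⟩
  · refine intervalIntegral.integral_pos hR (hL.continuous.pow 2).continuousOn
      (fun _ _ => sq_nonneg _) ⟨0, left_mem_Icc.2 hR.le, pow_pos ?_ 2⟩
    exact lt_max_of_lt_left (by rw [soliton_zero]; linarith)
  · rw [← integral_soliton_sq hp, intervalIntegral.integral_of_le hR.le]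
    refine (integral_mono_of_nonneg (ae_of_all _ fun _ => sq_nonneg _)
      ((integrableOn_soliton_sq hp).mono_set hsub) (ae_of_all _ fun y => ?_)).trans
      (setIntegral_mono_set (integrableOn_soliton_sq hp) (ae_of_all _ fun _ => sq_nonneg _)
        hsub.eventuallyLE)
    exact pow_le_pow_left₀ (cutSoliton_nonneg _ _ _) (cutSoliton_le p y hδ0.le) 2
  · have h1 : ∫ y in (0 : ℝ)..R, deriv (cutSoliton p δ) y ^ 2 ≤ calibInt p 1 1 := by
      rw [← integral_solitonDeriv_sq hp, intervalIntegral.integral_of_le hR.le]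
      refine (integral_mono_of_nonneg (ae_of_all _ fun _ => sq_nonneg _)
        ((integrableOn_solitonDeriv_sq hp).mono_set hsub) (ae_of_all _ fun y => ?_)).trans
        (setIntegral_mono_set (integrableOn_solitonDeriv_sq hp) (ae_of_all _ fun _ => sq_nonneg _)
          hsub.eventuallyLE)
      exact sq_le_sq.2 (abs_deriv_le_of_abs_sub_le (hasDerivAt_soliton hp y)
        fun x => abs_cutSoliton_sub_le p δ x y)
    have h2 : ∫ y in (0 : ℝ)..R, cutSoliton p δ y ^ p = ∫ y in Ioi 0, cutSoliton p δ y ^ p := by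
      rw [intervalIntegral.integral_of_le hR.le]
      refine (setIntegral_eq_of_subset_of_forall_sdiff_eq_zero measurableSet_Ioi hsub
        fun y hy => ?_).symm
      have : R ≤ y := by
        by_contra! h
        exact hy.2 ⟨hy.1, h.le⟩
      rw [hsupp y this, Real.zero_rpow hp0.ne']
    have h3 := integral_soliton_rpow hp
    have h4 : 1 / p * ((∫ y in Ioi 0, soliton p y ^ p) - p * η) <
        1 / p * ∫ y in Ioi 0, cutSoliton p δ y ^ p := by gcongr
    rw [mul_sub, h3, ← mul_assoc, one_div_mul_cancel hp0.ne', one_mul] at h4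
    rw [h2]
    linarith

/-! ### Functions supported on a single edge -/

/-- Admissible centres of a bump on `[0, l]`: an endpoint carries `1` half of the bump, the
midpoint carries `2` halves. -/
def IsBumpCentre (l x₀ N : ℝ) : Prop :=
  N = 1 ∧ (x₀ = 0 ∨ x₀ = l) ∨ N = 2 ∧ x₀ = l / 2

/-- Substitute y = k(x - x₀). By evenness each half of the bump inside the edge contributes the same
integral, and `hRk` makes every half fit. -/
lemma integral_bump {ψ : ℝ → ℝ} {l x₀ N R k : ℝ} (hc : IsBumpCentre l x₀ N) (hl : 0 < l)
    (hk : 0 < k) (hR : 0 < R) (hRk : R ≤ k * (l / 2)) (heven : ∀ y, ψ (-y) = ψ y)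
    (hsupp : ∀ y, R < y → ψ y = 0) (hψ : IntervalIntegrable ψ volume 0 R) :
    ∫ x in (0 : ℝ)..l, ψ (k * (x - x₀)) = N / k * ∫ y in (0 : ℝ)..R, ψ y := by
  have hz : ∀ T, R ≤ T →
      ∫ y in (0 : ℝ)..T, ψ y = ∫ y in (0 : ℝ)..R, ψ y ∧ IntervalIntegrable ψ volume 0 T := by
    intro T hT
    have hdiff : ∀ y ∈ Ioc 0 T \ Ioc 0 R, ψ y = 0 := fun y hy => hsupp y <| by
      by_contra! h
      exact hy.2 ⟨hy.1.1, h⟩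
    rw [intervalIntegrable_iff_integrableOn_Ioc_of_le (hR.le.trans hT),
      intervalIntegral.integral_of_le hR.le, intervalIntegral.integral_of_le (hR.le.trans hT)]
    rw [intervalIntegrable_iff_integrableOn_Ioc_of_le hR.le] at hψ
    exact ⟨setIntegral_eq_of_subset_of_forall_sdiff_eq_zero measurableSet_Ioc
      (Ioc_subset_Ioc_right hT) hdiff, hψ.of_forall_sdiff_eq_zero measurableSet_Ioc hdiff⟩
  have hneg : ∀ T, ∫ y in -T..0, ψ y = ∫ y in (0 : ℝ)..T, ψ y := by
    intro T
    have := intervalIntegral.integral_comp_neg (a := 0) (b := T) ψ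
    simp only [heven, neg_zero] at this
    exact this.symm
  have hcomp : ∫ x in (0 : ℝ)..l, ψ (k * (x - x₀)) =
      k⁻¹ * ∫ y in (k * (0 - x₀))..(k * (l - x₀)), ψ y := by
    simp only [mul_sub]
    exact intervalIntegral.integral_comp_mul_sub ψ hk.ne' (k * x₀)
  have hRl : R ≤ k * l := hRk.trans (by nlinarith)
  rw [hcomp]
  rcases hc with ⟨rfl, rfl | rfl⟩ | ⟨rfl, rfl⟩
  · simp only [sub_zero, mul_zero]
    rw [(hz _ hRl).1, one_div]
  · rw [sub_self, mul_zero, zero_sub, mul_neg, hneg, (hz _ hRl).1, one_div]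
  · have i1 := (hz _ hRk).2
    have i2 : IntervalIntegrable ψ volume (-(k * (l / 2))) 0 := by
      have := (IntervalIntegrable.iff_comp_neg (by finiteness)).1 i1
      simp only [heven, neg_zero] at this
      exact this.symm
    rw [zero_sub, mul_neg, sub_half, ← intervalIntegral.integral_add_adjacent_intervals i2 i1,
      hneg, (hz _ hRk).1]
    ring

namespace MetricGraph

variable {V B H : Type*} {G : MetricGraph V B H}

/-- No edge end other than one end of `e` is attached at `y`. -/
def IsTip (G : MetricGraph V B H) (e : B) (y : V) : Prop :=
  (∀ b, G.src b = y ∨ G.tgt b = y → b = e) ∧ (∀ h, G.base h ≠ y) ∧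
    ¬ (G.src e = y ∧ G.tgt e = y)

lemma isTip_of_degree_eq_one [Finite B] [Finite H] {e : B} {y : V}
    (he : G.src e = y ∨ G.tgt e = y) (hdeg : G.degree y = 1) : G.IsTip e y := by
  have hu : ∀ {b c : B}, G.src b = y → G.src c = y → b = c := by
    intro b c hb hc
    by_contra hne
    have : 1 < Nat.card {b : B // G.src b = y} :=
      Finite.one_lt_card_iff_nontrivial.2 ⟨⟨b, hb⟩, ⟨c, hc⟩, fun h => hne (congrArg Subtype.val h)⟩
    unfold degree at hdeg
    omega
  have hu' : ∀ {b c : B}, G.tgt b = y → G.tgt c = y → b = c := by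
    intro b c hb hc
    by_contra hne
    have : 1 < Nat.card {b : B // G.tgt b = y} :=
      Finite.one_lt_card_iff_nontrivial.2 ⟨⟨b, hb⟩, ⟨c, hc⟩, fun h => hne (congrArg Subtype.val h)⟩
    unfold degree at hdeg
    omega
  have hs : ∀ {b : B}, G.src b = y → 0 < Nat.card {b : B // G.src b = y} := fun {b} hb =>
    have : Nonempty {b : B // G.src b = y} := ⟨⟨b, hb⟩⟩
    Nat.card_pos
  have ht : ∀ {b : B}, G.tgt b = y → 0 < Nat.card {b : B // G.tgt b = y} := fun {b} hb =>
    have : Nonempty {b : B // G.tgt b = y} := ⟨⟨b, hb⟩⟩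
    Nat.card_pos
  have hh : ∀ {h : H}, G.base h = y → 0 < Nat.card {h : H // G.base h = y} := fun {h} hb =>
    have : Nonempty {h : H // G.base h = y} := ⟨⟨h, hb⟩⟩
    Nat.card_pos
  have hst : ∀ {b c : B}, G.src b = y → G.tgt c = y → False := by
    intro b c hb hc
    have := hs hb
    have := ht hc
    unfold degree at hdeg
    omega
  refine ⟨fun b hb => ?_, fun h hb => ?_, fun h => hst h.1 h.2⟩
  · rcases hb with hb | hb <;> rcases he with he | he
    · exact hu hb he
    · exact (hst hb he).elim
    · exact (hst he hb).elim
    · exact hu' hb he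
  · have := hh hb
    rcases he with he | he
    · have := hs he
      unfold degree at hdeg
      omega
    · have := ht he
      unfold degree at hdeg
      omega

section bump

open Classical in
/-- The function equal to `g` on the edge `e` and to `0` on the other edges. -/
noncomputable def bump (G : MetricGraph V B H) (e : B) (g : ℝ → ℝ)
    (hs : g 0 = 0 ∨ G.IsTip e (G.src e)) (ht : g (G.len e) = 0 ∨ G.IsTip e (G.tgt e)) :
    G.Pt → ℝ :=
  -- A vertex receives the sum of the values of `g` at the ends of `e` attached there. This is
  -- compatible with the gluing because a nonzero end value is allowed only at a tip, where no other
  -- edge end is attached.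
  Quot.lift
    (Sum.elim
      (fun y => (if G.src e = y then g 0 else 0) + (if G.tgt e = y then g (G.len e) else 0))
      fun z => if z.1 = Sum.inl e then g z.2 else 0) <| by
    rintro _ _ (b | b | h)
    · simp only [Sum.elim_inr, Sum.elim_inl, Sum.inl.injEq]
      by_cases hb : b = e
      · subst hb
        have : ¬ (G.tgt b = G.src b ∧ g (G.len b) ≠ 0) := fun h =>
          (ht.resolve_left h.2).2.2 ⟨h.1.symm, rfl⟩
        grind
      · have h1 : ¬ (G.src e = G.src b ∧ g 0 ≠ 0) := fun h =>
          hb ((hs.resolve_left h.2).1 b (Or.inl h.1.symm))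
        have h2 : ¬ (G.tgt e = G.src b ∧ g (G.len e) ≠ 0) := fun h =>
          hb ((ht.resolve_left h.2).1 b (Or.inl h.1.symm))
        grind
    · simp only [Sum.elim_inr, Sum.elim_inl, Sum.inl.injEq]
      by_cases hb : b = e
      · subst hb
        have : ¬ (G.src b = G.tgt b ∧ g 0 ≠ 0) := fun h =>
          (hs.resolve_left h.2).2.2 ⟨rfl, h.1.symm⟩
        grind
      · have h1 : ¬ (G.src e = G.tgt b ∧ g 0 ≠ 0) := fun h =>
          hb ((hs.resolve_left h.2).1 b (Or.inr h.1.symm))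
        have h2 : ¬ (G.tgt e = G.tgt b ∧ g (G.len e) ≠ 0) := fun h =>
          hb ((ht.resolve_left h.2).1 b (Or.inr h.1.symm))
        grind
    · simp only [Sum.elim_inr, Sum.elim_inl, reduceCtorEq, if_false]
      have h1 : ¬ (G.src e = G.base h ∧ g 0 ≠ 0) := fun h' =>
        (hs.resolve_left h'.2).2.1 h h'.1.symm
      have h2 : ¬ (G.tgt e = G.base h ∧ g (G.len e) ≠ 0) := fun h' =>
        (ht.resolve_left h'.2).2.1 h h'.1.symm
      grind

variable {e : B} {g : ℝ → ℝ} (hs : g 0 = 0 ∨ G.IsTip e (G.src e))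
  (ht : g (G.len e) = 0 ∨ G.IsTip e (G.tgt e))

lemma bump_pt_self (x : G.dom (Sum.inl e)) : G.bump e g hs ht (G.pt (Sum.inl e) x) = g x :=
  if_pos rfl

lemma bump_pt_of_ne {a : B ⊕ H} (ha : a ≠ Sum.inl e) (x : G.dom a) :
    G.bump e g hs ht (G.pt a x) = 0 := if_neg ha

lemma onEdge_bump_self : G.onEdge (G.bump e g hs ht) (Sum.inl e) =
    IccExtend (G.len_pos e).le fun x => g x :=
  congrArg (IccExtend (G.len_pos e).le) (funext fun x => bump_pt_self hs ht x)

lemma onEdge_bump_of_ne {a : B ⊕ H} (ha : a ≠ Sum.inl e) :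
    G.onEdge (G.bump e g hs ht) a = fun _ => 0 := by
  rcases a with b | h
  · exact funext fun x => bump_pt_of_ne hs ht ha (projIcc 0 (G.len b) (G.len_pos b).le x)
  · exact funext fun x => bump_pt_of_ne hs ht ha (projIci 0 x)

lemma lipschitzWith_onEdge_bump {K : NNReal} (hg : LipschitzWith K g) :
    LipschitzWith K (G.onEdge (G.bump e g hs ht) (Sum.inl e)) := by
  rw [onEdge_bump_self]
  have := hg.comp (LipschitzWith.subtype_val _ |>.comp (LipschitzWith.projIcc (G.len_pos e).le))
  rw [one_mul, mul_one] at this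
  exact this

lemma memH1_bump {K : NNReal} (hg : LipschitzWith K g) : G.MemH1 (G.bump e g hs ht) := by
  intro a
  by_cases ha : a = Sum.inl e
  · subst ha
    have hL := lipschitzWith_onEdge_bump hs ht hg
    refine ⟨fun c _ => hL.lipschitzOnWith.absolutelyContinuousOnInterval, ?_, ?_⟩
    · obtain ⟨C, hC⟩ := isCompact_Icc.exists_bound_of_continuousOn
        (hL.continuous.continuousOn (s := Icc 0 (G.len e)))
      have : IsFiniteMeasure (volume.restrict (G.dom (Sum.inl e : B ⊕ H))) :=
        inferInstanceAs (IsFiniteMeasure (volume.restrict (Icc 0 (G.len e))))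
      exact MemLp.of_bound hL.continuous.aestronglyMeasurable C
        ((ae_restrict_iff' (G.measurableSet_dom _)).2 (ae_of_all _ hC))
    · have : IsFiniteMeasure (volume.restrict (G.dom (Sum.inl e : B ⊕ H))) :=
        inferInstanceAs (IsFiniteMeasure (volume.restrict (Icc 0 (G.len e))))
      exact MemLp.of_bound (measurable_deriv _).aestronglyMeasurable K
        (ae_of_all _ fun x => norm_deriv_le_of_lipschitz hL)
  · rw [onEdge_bump_of_ne hs ht ha]
    refine ⟨fun c _ =>
      (LipschitzWith.const (0 : ℝ)).lipschitzOnWith.absolutelyContinuousOnInterval, ?_, ?_⟩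
    · exact MemLp.zero
    · simp only [deriv_const']
      exact MemLp.zero

lemma bump_mem_maxOn {K : NNReal} [Nonempty H] (hG : G.Connected) (hg : LipschitzWith K g) :
    G.bump e g hs ht ∈ G.maxOn e := by
  refine ⟨memH1_bump hs ht hg, le_antisymm (biSup_mono fun _ _ => mem_univ _) ?_⟩
  refine iSup₂_le fun P _ => ?_
  obtain ⟨a, x, rfl⟩ := hG.exists_pt_eq P
  by_cases ha : a = Sum.inl e
  · subst ha
    exact le_iSup₂_of_le (G.pt _ x) ⟨x, rfl⟩ le_rfl
  · rw [bump_pt_of_ne hs ht ha]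
    simp

variable [Fintype B] [Fintype H]

lemma mass_bump : G.mass (G.bump e g hs ht) = ∫ x in (0 : ℝ)..G.len e, g x ^ 2 := by
  unfold mass
  rw [Fintype.sum_eq_single (Sum.inl e) fun a ha => by simp [onEdge_bump_of_ne hs ht ha],
    intervalIntegral.integral_of_le (G.len_pos e).le, ← integral_Icc_eq_integral_Ioc]
  refine setIntegral_congr_fun measurableSet_Icc fun x hx => ?_
  rw [onEdge_apply _ _ _ hx, bump_pt_self]

lemma energy_bump {p : ℝ} (hp : p ≠ 0) : G.energy p (G.bump e g hs ht) =
    1 / 2 * (∫ x in (0 : ℝ)..G.len e, deriv g x ^ 2) -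
      1 / p * ∫ x in (0 : ℝ)..G.len e, |g x| ^ p := by
  unfold energy dirichlet
  rw [Fintype.sum_eq_single (Sum.inl e) fun a ha => by simp [onEdge_bump_of_ne hs ht ha],
    Fintype.sum_eq_single (Sum.inl e) fun a ha => by simp [onEdge_bump_of_ne hs ht ha, hp],
    intervalIntegral.integral_of_le (G.len_pos e).le,
    intervalIntegral.integral_of_le (G.len_pos e).le, ← integral_Icc_eq_integral_Ioc,
    ← integral_Icc_eq_integral_Ioc]
  congr 2
  -- The endpoints are discarded: there the derivative of the constant extension may differ from
  -- that of `g`.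
  · rw [show G.dom (Sum.inl e : B ⊕ H) = Icc 0 (G.len e) from rfl, integral_Icc_eq_integral_Ioo,
      integral_Icc_eq_integral_Ioo]
    refine setIntegral_congr_fun measurableSet_Ioo fun x hx => ?_
    have : G.onEdge (G.bump e g hs ht) (Sum.inl e) =ᶠ[nhds x] g := by
      filter_upwards [Ioo_mem_nhds hx.1 hx.2] with y hy
      rw [onEdge_apply _ _ _ (Ioo_subset_Icc_self hy), bump_pt_self]
    rw [this.deriv_eq]
  · refine setIntegral_congr_fun measurableSet_Icc fun x hx => ?_
    rw [onEdge_apply _ _ _ hx, bump_pt_self]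

end bump

end MetricGraph

/-! ### The numerical comparison of energies -/

/-- By Bernoulli r - 1 + y^r - r y ≥ 0, so a full y^r is to spare; it dominates 1 + √y once y ≥ y₀.
For y ≤ y₀ the choice of y₀ makes r y at most half of r - 1. In the margin, the constant absorbs the
truncation error of the soliton and √y absorbs Φ(δ). -/
lemma exists_mul_one_add_sqrt_le {r : ℝ} (hr : 1 < r) :
    ∃ c : ℝ, 0 < c ∧ ∀ y : ℝ, 0 ≤ y → c * (1 + √y) ≤ r - 1 + 2 * y ^ r - r * y := by
  set y₀ := (r - 1) / (2 * r) with hy₀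
  have hr0 : 0 < r - 1 := by linarith
  have hy0 : 0 < y₀ := by positivity
  have hy1 : y₀ ≤ 1 := by
    rw [hy₀, div_le_one (by positivity)]
    linarith
  have hc : 0 < y₀ ^ r := Real.rpow_pos_of_pos hy0 r
  refine ⟨min (y₀ ^ r / 2) ((r - 1) / 4), lt_min (by positivity) (by positivity), fun y hy => ?_⟩
  rcases le_total y₀ y with h | h
  · have hy' : 0 < y := hy0.trans_le h
    have hb := one_add_mul_self_le_rpow_one_add (s := y - 1) (p := r) (by linarith) hr.le
    rw [add_sub_cancel] at hb
    have h1 : y₀ ^ r ≤ y ^ r := Real.rpow_le_rpow hy0.le h (by linarith)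
    have h2 : y₀ ^ r * √y ≤ y ^ r := by
      have e : y ^ r = y ^ (r - 1 / 2) * √y := by
        rw [Real.sqrt_eq_rpow, ← Real.rpow_add hy', sub_add_cancel]
      rw [e]
      refine mul_le_mul_of_nonneg_right ?_ (Real.sqrt_nonneg y)
      exact (Real.rpow_le_rpow_of_exponent_ge hy0 hy1 (by linarith)).trans
        (Real.rpow_le_rpow hy0.le h (by linarith))
    calc _ ≤ y₀ ^ r / 2 * (1 + √y) :=
          mul_le_mul_of_nonneg_right (min_le_left _ _) (by positivity)
      _ ≤ _ := by nlinarith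
  · have h1 : r * y ≤ (r - 1) / 2 := by
      calc r * y ≤ r * y₀ := by gcongr
        _ = (r - 1) / 2 := by rw [hy₀]; field_simp
    have h2 : √y ≤ 1 := Real.sqrt_le_one.2 (h.trans hy1)
    have h3 := Real.rpow_nonneg hy r
    calc _ ≤ (r - 1) / 4 * (1 + √y) :=
          mul_le_mul_of_nonneg_right (min_le_right _ _) (by positivity)
      _ ≤ _ := by nlinarith

/-- Comparison of the lower energy bound with `N + 1` branches and the energy of a bump with `N`
branches and amplitude `A`. -/
lemma bump_energy_le_lower_bound {p N A m l M C c μ : ℝ} (hp : 2 < p) (hN1 : 1 ≤ N) (hN2 : N ≤ 2)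
    (hA : 0 < A) (hm : 0 < m) (hl : 0 < l) (hM : 0 ≤ M) (hC : 0 < C)
    (hmC : m ≤ p * ((p / 2 + 1) / (p - 2)) * C)
    (hc : ∀ y : ℝ, 0 ≤ y → c * (1 + √y) ≤
      (p / 2 + 1) / (p - 2) - 1 + 2 * y ^ ((p / 2 + 1) / (p - 2)) - (p / 2 + 1) / (p - 2) * y)
    (hAl : 3 * (√(2 / p) * m / l) ≤ C * c * A ^ (p / 2 - 1))
    (hr : 1 < (p / 2 + 1) / (p - 2))
    (hμ : μ = N * A ^ (3 - p / 2) * m) :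
    N * A ^ (p / 2 + 1) * (C * c / 2 - ((p / 2 + 1) / (p - 2) - 1) * C) ≤
      (N + 1) * (M ^ (p / 2 + 1) * C - √(2 / p) * M ^ (p / 2 - 1) * (μ / l / 2)) -
        M ^ (p - 2) / p * μ := by
  have hp0 : 0 < p := by linarith
  have hp2 : p - 2 ≠ 0 := by linarith
  set r := (p / 2 + 1) / (p - 2) with hrdef
  -- Measuring M in units of A makes every main term a multiple of A^(p/2+1), and only y =
  -- (M/A)^(p-2) remains as a variable.
  obtain ⟨t, ht, rfl⟩ : ∃ t, 0 ≤ t ∧ M = A * t := ⟨M / A, by positivity, by field_simp⟩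
  set y := t ^ (p - 2) with hy
  have hy0 : 0 ≤ y := Real.rpow_nonneg ht _
  have e1 : t ^ (p / 2 + 1) = y ^ r := by
    rw [hy, ← Real.rpow_mul ht, hrdef]
    field_simp
  have e2 : t ^ (p / 2 - 1) = √y := by
    rw [hy, Real.sqrt_eq_rpow, ← Real.rpow_mul ht]
    ring_nf
  rw [Real.mul_rpow hA.le ht, Real.mul_rpow hA.le ht, Real.mul_rpow hA.le ht, e1, e2, ← hy]
  set a := A ^ (p / 2 + 1) with ha
  have ha0 : 0 < a := Real.rpow_pos_of_pos hA _
  have e3 : A ^ (p - 2) * A ^ (3 - p / 2) = a := by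
    rw [ha, ← Real.rpow_add hA]; ring_nf
  have e4 : A ^ (p / 2 - 1) * A ^ (3 - p / 2) * A ^ (p / 2 - 1) = a := by
    rw [ha, ← Real.rpow_add hA, ← Real.rpow_add hA]; ring_nf
  set q := A ^ (p / 2 - 1) with hq
  have hq0 : 0 < q := Real.rpow_pos_of_pos hA _
  have hs := Real.sqrt_nonneg y
  have hb := one_add_mul_self_le_rpow_one_add (s := y - 1) (p := r) (by linarith) hr.le
  rw [add_sub_cancel] at hb
  have hcy := hc y hy0
  have t1 : A ^ (p - 2) * y / p * μ ≤ a * (N * r * C * y) := by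
    calc A ^ (p - 2) * y / p * μ = A ^ (p - 2) * A ^ (3 - p / 2) * (N * y / p) * m := by
          rw [hμ]; ring
      _ ≤ a * (N * y / p) * (p * r * C) := by
          rw [e3]; gcongr
      _ = _ := by field_simp
  -- The error from Φ(δ) has order A², smaller than A^(p/2+1) by the factor A^(p/2-1); the 3 in
  -- `hAl` is the bound of N(N+1)/2 for N ≤ 2.
  have t2 : (N + 1) * (√(2 / p) * (q * √y) * (μ / l / 2)) ≤ a * (C * c * √y) := by
    have h3 : √(2 / p) * m / l ≤ C * c * q / 3 := by linarith
    have hz : 0 ≤ q * A ^ (3 - p / 2) := by positivity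
    have hNN : (N + 1) * N / 2 ≤ 3 := by nlinarith
    calc _ = (q * A ^ (3 - p / 2)) * √y * ((N + 1) * N / 2) * (√(2 / p) * m / l) := by
          rw [hμ]; ring
      _ ≤ (q * A ^ (3 - p / 2)) * √y * 3 * (C * c * q / 3) := by gcongr
      _ = (q * A ^ (3 - p / 2) * q) * (C * c * √y) := by ring
      _ = _ := by rw [e4]
  -- Passing from N = 1 to general N adds N - 1 copies of the nonnegative Bernoulli expression. The
  -- loss N C c/2 is at most C c, the constant part of the margin.
  have key : N * (C * c / 2 - (r - 1) * C) ≤ (N + 1) * (y ^ r * C) - N * r * C * y - C * c * √y := by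
    have h4 : 0 ≤ (N - 1) * (C * (r - 1 + y ^ r - r * y)) :=
      mul_nonneg (by linarith) (mul_nonneg hC.le (by linarith))
    have h5 : C * (c * (1 + √y)) ≤ C * (r - 1 + 2 * y ^ r - r * y) := by gcongr
    have h6 : 0 < C * c := by
      have : 0 < C * c * q := lt_of_lt_of_le (by positivity) hAl
      exact pos_of_mul_pos_left this hq0.le
    nlinarith
  have := mul_le_mul_of_nonneg_left key ha0.le
  nlinarith

/-! ### The competitor and the location of peaks -/

namespace MetricGraph

variable {V B H : Type*} {G : MetricGraph V B H}

/-- Soliton scaling A h(k(x - x₀)) with k = A^(p/2-1): the Dirichlet term scales as A²k and the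
potential as A^p/k, both equal to A^(p/2+1), while the mass scales as A²/k = A^(3-p/2). -/
lemma exists_bump_energy_eq [Fintype B] [Fintype H] [Nonempty H] (hG : G.Connected) {p : ℝ}
    (hp : 2 < p) {h : ℝ → ℝ} {R : ℝ} {K : NNReal} (hR : 0 < R) (hK : LipschitzWith K h)
    (heven : ∀ y, h (-y) = h y) (hnn : ∀ y, 0 ≤ h y) (hsupp : ∀ y, R ≤ y → h y = 0)
    {e : B} {x₀ N A : ℝ} (hc : IsBumpCentre (G.len e) x₀ N) (hA : 0 < A)
    (hRA : R ≤ A ^ (p / 2 - 1) * (G.len e / 2))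
    (hs : x₀ = 0 → G.IsTip e (G.src e)) (ht : x₀ = G.len e → G.IsTip e (G.tgt e)) :
    ∃ v ∈ G.maxOn e, G.mass v = N * A ^ (3 - p / 2) * (∫ y in (0 : ℝ)..R, h y ^ 2) ∧
      G.energy p v = N * A ^ (p / 2 + 1) * (1 / 2 * (∫ y in (0 : ℝ)..R, deriv h y ^ 2) -
        1 / p * ∫ y in (0 : ℝ)..R, h y ^ p) := by
  have hl := G.len_pos e
  set k := A ^ (p / 2 - 1) with hk
  have hk0 : 0 < k := Real.rpow_pos_of_pos hA _
  have hkl : R ≤ k * G.len e := hRA.trans (by nlinarith)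
  let g : ℝ → ℝ := fun x => A * h (k * (x - x₀))
  have hgL : LipschitzWith (A.toNNReal * (K * k.toNNReal)) g := by
    refine LipschitzWith.of_dist_le_mul fun x y => ?_
    have := hK.dist_le_mul (k * (x - x₀)) (k * (y - x₀))
    simp only [g, Real.dist_eq, NNReal.coe_mul, Real.coe_toNNReal _ hA.le,
      Real.coe_toNNReal _ hk0.le] at this ⊢
    rw [← mul_sub, abs_mul, abs_of_pos hk0, sub_sub_sub_cancel_right] at this
    rw [← mul_sub, abs_mul, abs_of_pos hA]
    calc _ ≤ A * (K * (k * |x - y|)) := by gcongr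
      _ = _ := by ring
  have hs' : g 0 = 0 ∨ G.IsTip e (G.src e) := by
    by_cases h0 : x₀ = 0
    · exact Or.inr (hs h0)
    · left
      have : R ≤ k * x₀ := by
        rcases hc with ⟨-, h | h⟩ | ⟨-, h⟩
        · exact absurd h h0
        · rwa [h]
        · rwa [h]
      simp only [g]
      rw [zero_sub, mul_neg, heven, hsupp _ this, mul_zero]
  have ht' : g (G.len e) = 0 ∨ G.IsTip e (G.tgt e) := by
    by_cases h0 : x₀ = G.len e
    · exact Or.inr (ht h0)
    · left
      have : R ≤ k * (G.len e - x₀) := by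
        rcases hc with ⟨-, h | h⟩ | ⟨-, h⟩
        · rwa [h, sub_zero]
        · exact absurd h h0
        · rwa [h, sub_half]
      simp only [g]
      rw [hsupp _ this, mul_zero]
  have hhc := hK.continuous
  have i1 := integral_bump (ψ := fun y => h y ^ 2) hc hl hk0 hR hRA (fun y => by rw [heven])
    (fun y hy => by rw [hsupp y hy.le]; simp) ((hhc.pow 2).intervalIntegrable _ _)
  have i2 := integral_bump (ψ := fun y => h y ^ p) hc hl hk0 hR hRA (fun y => by rw [heven])
    (fun y hy => by rw [hsupp y hy.le, Real.zero_rpow (by linarith)])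
    ((hhc.rpow_const fun _ => Or.inr (by linarith)).intervalIntegrable _ _)
  have i3 := integral_bump (ψ := fun y => deriv h y ^ 2) hc hl hk0 hR hRA
    (fun y => by
      have : deriv h y = -deriv h (-y) := by
        rw [← deriv_comp_neg]
        exact congrArg (fun f => deriv f y) (funext fun z => (heven z).symm)
      rw [this, neg_sq])
    (fun y hy => by
      have : h =ᶠ[nhds y] fun _ => 0 := by
        filter_upwards [Ioi_mem_nhds hy] with z hz
        exact hsupp z (le_of_lt hz)
      rw [this.deriv_eq]
      simp)
    (by
      rw [intervalIntegrable_iff_integrableOn_Ioc_of_le hR.le]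
      refine Measure.integrableOn_of_bounded (M := (K : ℝ) ^ 2) measure_Ioc_lt_top.ne
        ((measurable_deriv h).pow_const 2).aestronglyMeasurable (ae_of_all _ fun y => ?_)
      rw [norm_pow]
      exact pow_le_pow_left₀ (norm_nonneg _) (norm_deriv_le_of_lipschitz hK) 2)
  have hd : ∀ x, deriv g x = A * (k * deriv h (k * (x - x₀))) := by
    intro x
    have h1 : deriv (fun x => h (k * (x - x₀))) x = deriv (fun z => h (k * z)) (x - x₀) :=
      deriv_comp_sub_const (f := fun z => h (k * z)) x₀ x
    simp only [g]
    rw [deriv_const_mul_field, h1, deriv_comp_mul_left, smul_eq_mul]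
  have hexp : ∀ s : ℝ, A ^ s / k = A ^ (s - (p / 2 - 1)) := fun s => (Real.rpow_sub hA _ _).symm
  refine ⟨G.bump e g hs' ht', bump_mem_maxOn hs' ht' hG hgL, ?_, ?_⟩
  · rw [mass_bump]
    simp only [g, mul_pow]
    rw [intervalIntegral.integral_const_mul, i1]
    have := hexp 2
    rw [Real.rpow_two, show (2 : ℝ) - (p / 2 - 1) = 3 - p / 2 by ring] at this
    rw [← this]
    ring
  · rw [energy_bump hs' ht' (by linarith)]
    have hg : ∀ x, |g x| ^ p = A ^ p * h (k * (x - x₀)) ^ p := fun x => by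
      rw [abs_of_nonneg (mul_nonneg hA.le (hnn _)), Real.mul_rpow hA.le (hnn _)]
    simp only [hg, hd, mul_pow]
    rw [intervalIntegral.integral_const_mul, intervalIntegral.integral_const_mul,
      intervalIntegral.integral_const_mul, i2, i3]
    have e1 := hexp p
    rw [show p - (p / 2 - 1) = p / 2 + 1 by ring] at e1
    have e2 : A ^ 2 * (k ^ 2 / k) = A ^ (p / 2 + 1) := by
      rw [sq k, mul_div_cancel_right₀ _ hk0.ne', hk, ← Real.rpow_two, ← Real.rpow_add hA]
      ring_nf
    have e3 : A ^ 2 * (k ^ 2 * (N / k * ∫ y in (0 : ℝ)..R, deriv h y ^ 2)) =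
        A ^ 2 * (k ^ 2 / k) * (N * ∫ y in (0 : ℝ)..R, deriv h y ^ 2) := by ring
    have e4 : A ^ p * (N / k * ∫ y in (0 : ℝ)..R, h y ^ p) =
        A ^ p / k * (N * ∫ y in (0 : ℝ)..R, h y ^ p) := by ring
    rw [e3, e4, e2, e1]
    ring

lemma supNorm_le_iff {u : G.Pt → ℝ} {S : Set G.Pt} {c : ℝ≥0∞} :
    G.supNorm u S ≤ c ↔ ∀ x ∈ S, ‖u x‖ₑ ≤ c := iSup₂_le_iff

lemma enorm_le_supNorm {u : G.Pt → ℝ} {S : Set G.Pt} {x : G.Pt} (hx : x ∈ S) :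
    ‖u x‖ₑ ≤ G.supNorm u S := le_iSup₂_of_le x hx le_rfl

lemma peaksOn_of_le_supNorm {u : G.Pt → ℝ} {M : ℝ} {a : B ⊕ H}
    (h : ENNReal.ofReal M ≤ G.supNorm u (G.edge a)) : PeaksOn u M a := by
  intro t ht
  rcases lt_or_ge t 0 with ht0 | ht0
  · exact ⟨0, G.zero_mem_dom a, ht0.trans_le (abs_nonneg _)⟩
  by_contra! hall
  refine ((ENNReal.ofReal_lt_ofReal_iff (ht0.trans_lt ht)).2 ht).not_ge (h.trans ?_)
  refine supNorm_le_iff.2 ?_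
  rintro _ ⟨x, rfl⟩
  rw [Real.enorm_eq_ofReal_abs]
  have := hall x x.2
  rw [onEdge_apply _ _ _ x.2] at this
  exact ENNReal.ofReal_le_ofReal this

lemma MemH1.exists_supNorm_eq [Fintype B] [Fintype H] [Nonempty H] (hG : G.Connected)
    {u : G.Pt → ℝ} (hu : G.MemH1 u) :
    ∃ M : ℝ, 0 ≤ M ∧ G.supNorm u univ = ENNReal.ofReal M ∧ ∀ P, |u P| ≤ M := by
  obtain ⟨l, hl, hl1, hlen⟩ := exists_len_lower_bound G
  set s := G.mass u + G.dirichlet u + 1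
  have h0 : 0 ≤ G.mass u + G.dirichlet u := add_nonneg (mass_nonneg u) (dirichlet_nonneg u)
  have hle : G.supNorm u univ ≤ ENNReal.ofReal (s * (1 / √l + 1)) := by
    refine supNorm_le_iff.2 fun P _ => ?_
    obtain ⟨a, x, rfl⟩ := hG.exists_pt_eq P
    rw [Real.enorm_eq_ofReal_abs]
    exact ENNReal.ofReal_le_ofReal (hu.abs_le hl hl1 hlen (by positivity) (by nlinarith) a x)
  have hfin : G.supNorm u univ ≠ ⊤ := (hle.trans_lt ENNReal.ofReal_lt_top).ne
  refine ⟨(G.supNorm u univ).toReal, ENNReal.toReal_nonneg, (ENNReal.ofReal_toReal hfin).symm,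
    fun P => ?_⟩
  have := ENNReal.toReal_mono hfin (enorm_le_supNorm (u := u) (mem_univ P))
  simpa using this

/-- If `|u|` reaches its supremum outside `e`, it does so on some other edge. -/
lemma exists_peaksOn_ne [Fintype B] [Fintype H] [Nonempty H] (hG : G.Connected) {u : G.Pt → ℝ}
    {M : ℝ} (hM : 0 ≤ M) {e : B}
    (h : ENNReal.ofReal M ≤ G.supNorm u (G.edge (Sum.inl e))ᶜ) :
    ∃ f : B ⊕ H, f ≠ Sum.inl e ∧ PeaksOn u M f := by
  classical
  rcases hM.eq_or_lt with rfl | hM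
  -- If M = 0 the set off `e` carries no information, and any halfline serves as the other edge.
  · obtain ⟨i⟩ := ‹Nonempty H›
    exact ⟨Sum.inr i, by simp, fun t ht => ⟨0, G.zero_mem_dom _, ht.trans_le (abs_nonneg _)⟩⟩
  by_contra! hall
  have hlt : ∀ f ∈ Finset.univ.filter (· ≠ Sum.inl e),
      G.supNorm u (G.edge f) < ENNReal.ofReal M := by
    intro f hf
    by_contra! hge
    exact hall f (Finset.mem_filter.1 hf).2 (peaksOn_of_le_supNorm hge)
  refine ((Finset.sup_lt_iff (ENNReal.ofReal_pos.2 hM)).2 hlt).not_ge (h.trans ?_)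
  refine supNorm_le_iff.2 fun P hP => ?_
  obtain ⟨a, x, rfl⟩ := hG.exists_pt_eq P
  have ha : a ≠ Sum.inl e := by
    rintro rfl
    exact hP ⟨x, rfl⟩
  exact (enorm_le_supNorm (u := u) (show G.pt a x ∈ G.edge a from ⟨x, rfl⟩)).trans
    (Finset.le_sup (f := fun f => G.supNorm u (G.edge f))
      (Finset.mem_filter.2 ⟨Finset.mem_univ a, ha⟩))

/-- Admissible centre of the bump on `e`, with the number of branches of a two-peaked function. -/
lemma MemH1.exists_centre_and_lower_bound [Fintype B] [Fintype H] {u : G.Pt → ℝ} (hu : G.MemH1 u)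
    {p M δ : ℝ} (hp : 2 < p) (hM : ∀ P, |u P| ≤ M) (hM0 : 0 ≤ M) (hδ : LowOnEdges u δ) {e : B}
    {f : B ⊕ H} (hs : G.degree (G.src e) ≠ 2) (ht : G.degree (G.tgt e) ≠ 2) (hf : f ≠ Sum.inl e)
    (hpe : PeaksOn u M (Sum.inl e : B ⊕ H)) (hpf : PeaksOn u M f) :
    ∃ x₀ N, IsBumpCentre (G.len e) x₀ N ∧ (x₀ = 0 → G.IsTip e (G.src e)) ∧
      (x₀ = G.len e → G.IsTip e (G.tgt e)) ∧
      (N + 1) * (calibInt p M M - calibInt p M δ) ≤ ∑ c, action p M u c := by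
  have hl := G.len_pos e
  have h2 := hu.two_mul_le_sum_action hp hM hM0 hδ hf hpf hpe
  have d0 : 0 < G.degree (G.src e) := by
    have : Nonempty {b : B // G.src b = G.src e} := ⟨⟨e, rfl⟩⟩
    have := Nat.card_pos (α := {b : B // G.src b = G.src e})
    unfold degree
    omega
  have d1 : 0 < G.degree (G.tgt e) := by
    have : Nonempty {b : B // G.tgt b = G.tgt e} := ⟨⟨e, rfl⟩⟩
    have := Nat.card_pos (α := {b : B // G.tgt b = G.tgt e})
    unfold degree
    omega
  by_cases hs1 : G.degree (G.src e) = 1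
  · exact ⟨0, 1, Or.inl ⟨rfl, Or.inl rfl⟩, fun _ => isTip_of_degree_eq_one (Or.inl rfl) hs1,
      fun h => absurd h hl.ne, by linarith⟩
  by_cases ht1 : G.degree (G.tgt e) = 1
  · exact ⟨G.len e, 1, Or.inl ⟨rfl, Or.inr rfl⟩, fun h => absurd h hl.ne',
      fun _ => isTip_of_degree_eq_one (Or.inr rfl) ht1, by linarith⟩
  have h3 := hu.three_mul_le_sum_action hp hM hM0 hδ (by omega) (by omega) hf hpe hpf
  exact ⟨G.len e / 2, 2, Or.inr ⟨rfl, rfl⟩, fun h => by linarith, fun h => by linarith,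
    by linarith⟩

/-- Above a critical mass, the peak of a constrained minimizer is not reached outside `e`. -/
lemma exists_mass_supNorm_compl_lt [Fintype B] [Fintype H] [Nonempty H] (hG : G.Connected) {p : ℝ}
    (hp2 : 2 < p) (hp6 : p < 6) :
    ∃ μ₀ : ℝ, 0 < μ₀ ∧ ∀ e : B, G.degree (G.src e) ≠ 2 → G.degree (G.tgt e) ≠ 2 →
      ∀ μ : ℝ, μ₀ ≤ μ → ∀ u : G.Pt → ℝ, u ∈ G.maxOnMass e μ →
        (∀ v ∈ G.maxOnMass e μ, G.energy p u ≤ G.energy p v) →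
        G.supNorm u (G.edge (Sum.inl e))ᶜ < G.supNorm u (G.edge (Sum.inl e)) := by
  obtain ⟨l, hl, -, hlen⟩ := exists_len_lower_bound G
  have hb : 0 < p - 2 := by linarith
  have hr : 1 < (p / 2 + 1) / (p - 2) := by
    rw [lt_div_iff₀ hb]
    linarith
  have hC := calibInt_one_pos hp2
  obtain ⟨c, hc0, hc⟩ := exists_mul_one_add_sqrt_le hr
  obtain ⟨h, R, K, hR, hK, heven, hnn, hsupp, hm, hmC, hen⟩ :=
    exists_halfline_profile hp2 (show 0 < calibInt p 1 1 * c / 2 by positivity)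
  set C := calibInt p 1 1
  set m := ∫ y in (0 : ℝ)..R, h y ^ 2
  -- Lower threshold for A^(p/2-1): the first entry makes half of the bump fit into half of any
  -- bounded edge, the second makes the error from Φ(δ) absorbable.
  set T := max (R / (l / 2)) (3 * (√(2 / p) * m / l) / (C * c)) with hT
  have hT0 : 0 < T := lt_max_of_lt_left (by positivity)
  have hd : 0 < 3 - p / 2 := by linarith
  have hq : 0 < p / 2 - 1 := by linarith
  -- This mass yields A^(p/2-1) ≥ T for both N = 1 and N = 2, whence the factor 2; it depends on the
  -- graph only through l, not on `e`.
  refine ⟨2 * m * T ^ ((3 - p / 2) / (p / 2 - 1)), by positivity, ?_⟩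
  intro e hs ht μ hμ u hu hmin
  obtain ⟨⟨huH, hsup⟩, humass⟩ := hu
  obtain ⟨M, hM0, hMsup, hM⟩ := huH.exists_supNorm_eq hG
  by_contra! hcon
  have hpe : PeaksOn u M (Sum.inl e : B ⊕ H) := peaksOn_of_le_supNorm (by rw [hsup, hMsup])
  obtain ⟨f, hf, hpf⟩ := exists_peaksOn_ne hG hM0 (by rwa [← hMsup, ← hsup])
  have hlow := huH.lowOnEdges hl hlen
  rw [humass] at hlow
  obtain ⟨x₀, N, hcen, hx0, hx1, hlb⟩ :=
    huH.exists_centre_and_lower_bound hp2 hM hM0 hlow hs ht hf hpe hpf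
  have hN : 1 ≤ N ∧ N ≤ 2 := by
    rcases hcen with ⟨rfl, -⟩ | ⟨rfl, -⟩ <;> norm_num
  have hN0 : 0 < N := by linarith
  have hμ0 : 0 < μ := lt_of_lt_of_le (by positivity) hμ
  -- The amplitude for which the bump with N halves has mass exactly μ; the exponent is positive
  -- because p < 6.
  set A := (μ / (N * m)) ^ (1 / (3 - p / 2)) with hA
  have hA0 : 0 < A := by positivity
  have hAμ : μ = N * A ^ (3 - p / 2) * m := by
    rw [hA, ← Real.rpow_mul (by positivity), one_div_mul_cancel hd.ne', Real.rpow_one]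
    field_simp
  have hAT : T ≤ A ^ (p / 2 - 1) := by
    have h1 : T ^ ((3 - p / 2) / (p / 2 - 1)) ≤ μ / (N * m) := by
      rw [le_div_iff₀ (by positivity)]
      refine le_trans ?_ hμ
      have : 0 < T ^ ((3 - p / 2) / (p / 2 - 1)) * m := by positivity
      nlinarith
    have h2 := Real.rpow_le_rpow (by positivity) h1 (show 0 ≤ (p / 2 - 1) / (3 - p / 2) by positivity)
    rw [← Real.rpow_mul hT0.le, div_mul_div_cancel₀ hq.ne', div_self hd.ne', Real.rpow_one] at h2
    rw [hA, ← Real.rpow_mul (by positivity), one_div_mul_eq_div]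
    exact h2
  have hRA : R ≤ A ^ (p / 2 - 1) * (G.len e / 2) := by
    have h1 := (le_max_left _ _).trans hAT
    rw [div_le_iff₀ (by positivity)] at h1
    refine h1.trans ?_
    gcongr
    exact hlen e
  have hAl : 3 * (√(2 / p) * m / l) ≤ C * c * A ^ (p / 2 - 1) := by
    have h1 := (le_max_right _ _).trans hAT
    rw [div_le_iff₀ (by positivity)] at h1
    linarith
  obtain ⟨v, hv, hvm, hve⟩ := exists_bump_energy_eq hG hp2 hR hK heven hnn hsupp hcen hA0 hRA hx0 hx1
  have h1 := hmin v ⟨hv, hvm.trans hAμ.symm⟩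
  have h2 := huH.energy_add_eq hp2 hM
  have h3 := calibInt_le hp2 hM0 (Real.sqrt_nonneg (μ / l))
  rw [Real.sq_sqrt (by positivity)] at h3
  rw [calibInt_self hp2 hM0] at hlb
  have h4 := bump_energy_le_lower_bound hp2 hN.1 hN.2 hA0 hm hl hM0 hC hmC hc hAl hr hAμ
  have h5 : G.energy p v < N * A ^ (p / 2 + 1) *
      (C * c / 2 - ((p / 2 + 1) / (p - 2) - 1) * C) := by
    rw [hve]
    gcongr
  rw [humass] at h2
  have h6 := mul_le_mul_of_nonneg_left h3 (show 0 ≤ N + 1 by linarith)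
  linarith

/-- A strict gap between the suprema on `e` and off `e` is stable in `H¹(G)`. -/
lemma MemH1.exists_forall_mem_maxOn [Fintype B] [Fintype H] [Nonempty H] (hG : G.Connected)
    {u : G.Pt → ℝ} (hu : G.MemH1 u) {e : B} {P : G.Pt} (hP : P ∈ G.edge (Sum.inl e))
    (hlt : G.supNorm u (G.edge (Sum.inl e))ᶜ < ‖u P‖ₑ) :
    ∃ ε : ℝ, 0 < ε ∧ ∀ v : G.Pt → ℝ, G.MemH1 v → G.normH1 (v - u) < ε → v ∈ G.maxOn e := by
  obtain ⟨l, hl, hl1, hlen⟩ := exists_len_lower_bound G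
  set S := G.supNorm u (G.edge (Sum.inl e))ᶜ
  have hS : S ≠ ⊤ := (hlt.trans enorm_lt_top).ne
  have hd : S.toReal < |u P| := by
    have := (ENNReal.toReal_lt_toReal hS enorm_ne_top).2 hlt
    simpa using this
  have hκ : 0 < 1 / √l + 1 := by positivity
  -- With this radius the embedding keeps v within half the gap of u at every point, so |v| off `e`
  -- stays at most |v P|.
  have hε : 0 < (|u P| - S.toReal) / (2 * (1 / √l + 1)) :=
    div_pos (by linarith) (by positivity)
  refine ⟨_, hε, fun v hv hvu => ⟨hv, le_antisymm (biSup_mono fun _ _ => mem_univ _) ?_⟩⟩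
  have hclose : ∀ Q, |v Q - u Q| ≤ (|u P| - S.toReal) / 2 := by
    intro Q
    obtain ⟨a, x, rfl⟩ := hG.exists_pt_eq Q
    refine ((hv.sub hu).abs_le hl hl1 hlen hε ((Real.sqrt_lt' hε).1 hvu).le a x).trans_eq ?_
    field_simp
  refine supNorm_le_iff.2 fun Q _ => ?_
  by_cases hQ : Q ∈ G.edge (Sum.inl e)
  · exact enorm_le_supNorm hQ
  refine le_trans ?_ (enorm_le_supNorm hP)
  rw [Real.enorm_eq_ofReal_abs, Real.enorm_eq_ofReal_abs]
  refine ENNReal.ofReal_le_ofReal ?_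
  have h1 : |u Q| ≤ S.toReal := by
    have := ENNReal.toReal_mono hS (enorm_le_supNorm (u := u) hQ)
    simpa using this
  have h2 := hclose Q
  have h3 := hclose P
  have h4 := abs_sub_abs_le_abs_sub (v Q) (u Q)
  have h5 := abs_sub_abs_le_abs_sub (u P) (v P)
  rw [abs_sub_comm] at h5
  linarith

end MetricGraph

theorem lemma4p1 {V B H : Type*} [Fintype B] [Fintype H] [Nonempty H]
    (G : MetricGraph V B H) (hG : G.Connected) (p : ℝ) (hp2 : 2 < p) (hp6 : p < 6) :
    ∃ μ₀ : ℝ, 0 < μ₀ ∧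
      ∀ e : B, G.degree (G.src e) ≠ 2 → G.degree (G.tgt e) ≠ 2 →
        ∀ μ : ℝ, μ₀ ≤ μ →
          ∀ u : G.Pt → ℝ, u ∈ G.maxOnMass e μ →
            (∀ v ∈ G.maxOnMass e μ, G.energy p u ≤ G.energy p v) →
            G.supNorm u (G.edge (Sum.inl e))ᶜ < G.supNorm u (G.edge (Sum.inl e)) ∧
            ((∃ x ∈ G.edge (Sum.inl e), ‖u x‖ₑ = G.supNorm u univ) ∧
              ∀ x ∉ G.edge (Sum.inl e), ‖u x‖ₑ < G.supNorm u univ) ∧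
            ∃ ε : ℝ, 0 < ε ∧
              ∀ v : G.Pt → ℝ, G.MemH1 v → G.normH1 (v - u) < ε → v ∈ G.maxOn e := by
  obtain ⟨μ₀, hμ₀, H₀⟩ := MetricGraph.exists_mass_supNorm_compl_lt hG hp2 hp6
  refine ⟨μ₀, hμ₀, fun e hs ht μ hμ u hu hmin => ?_⟩
  have hlt := H₀ e hs ht μ hμ u hu hmin
  obtain ⟨⟨huH, hsup⟩, -⟩ := hu
  obtain ⟨M, hM0, hMsup, hM⟩ := huH.exists_supNorm_eq hG
  obtain ⟨x, hx, hxM⟩ := huH.exists_abs_eq_of_peaksOn hM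
    (MetricGraph.peaksOn_of_le_supNorm (a := Sum.inl e) (by rw [hsup, hMsup]))
  have hP : ‖u (G.pt (Sum.inl e) ⟨x, hx⟩)‖ₑ = G.supNorm u univ := by
    rw [hMsup, Real.enorm_eq_ofReal_abs, ← hxM, MetricGraph.onEdge_apply _ _ _ hx]
  refine ⟨hlt, ⟨⟨_, ⟨_, rfl⟩, hP⟩, fun Q hQ => ?_⟩, ?_⟩
  · exact (MetricGraph.enorm_le_supNorm hQ).trans_lt (hlt.trans_eq hsup)
  · exact huH.exists_forall_mem_maxOn hG ⟨_, rfl⟩ (by rw [hP, ← hsup]; exact hlt)
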